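/- Let $n\ge 1$ and let $\Omega\subset\mathbb{R}^n$ be a nonempty, bounded, open, convex polytopal set. Let $\mathcal{L}w=-\operatorname{div}(A\nabla w)+cw$, supplemented with homogeneous Dirichlet boundary conditions, where $0\le c\in L^\infty(\Omega)$ and $A\in C^{0,1}(\Omega;\mathbb{R}^{n\times n})$ is symmetric and uniformly positive definite. Let $\{(\lambda_k,\varphi_k)\}_{k\in\mathbb{N}}$ be the eigenpairs of $\mathcal{L}$, where $\varphi_k\in H^1_0(\Omega)$ are weak eigenfunctions forming an orthonormal basis of $L^2(\Omega)$. For $s\in(0,1)$ let $$\mathbb{H}^s(\Omega)=\Big\{w=\sum_k w_k\varphi_k\in L^2(\Omega):\ \sum_k\lambda_k^s|w_k|^2<\infty\Big\},\qquad \mathcal{L}^s w=\sum_k\lambda_k^s w_k\varphi_k,\qquad w_k=(w,\varphi_k)_{L^2(\Omega)},$$ where $\mathcal{L}^s$ maps $\mathbb{H}^s(\Omega)$ into its dual. Let $\sigma,\nu>0$, $\mathsf{a}<0<\mathsf{b}$, $\mathsf{u}_d\in L^2(\Omega)$, and put $$J(u,z)=\tfrac12\|u-\mathsf{u}_d\|_{L^2(\Omega)}^2+\tfrac{\sigma}{2}\|z\|_{L^2(\Omega)}^2+\nu\|z\|_{L^1(\Omega)},\qquad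 Z_{ad}=\{z\in L^2(\Omega):\ \mathsf{a}\le z\le \mathsf{b}\ \text{a.e. in }\Omega\}.$$ For every $z\in L^2(\Omega)$ the state equation $\mathcal{L}^s u=z$ has exactly one solution $u=:\mathbf{S}z\in\mathbb{H}^s(\Omega)$, and $\mathbf{S}:L^2(\Omega)\to L^2(\Omega)$ is linear and bounded; let $\mathbf{S}^\dagger$ be its $L^2(\Omega)$-adjoint. Call a pair $(\bar u,\bar z)\in\mathbb{H}^s(\Omega)\times Z_{ad}$ optimal if $\bar u=\mathbf{S}\bar z$ and $J(\bar u,\bar z)\le J(u,z)$ for all $(u,z)\in\mathbb{H}^s(\Omega)\times Z_{ad}$ with $u=\mathbf{S}z$. Let $\psi:L^1(\Omega)\to\mathbb{R}$, $\psi(z)=\|z\|_{L^1(\Omega)}$, and let $\partial\psi(\bar z)\subset L^1(\Omega)^*= L^\infty(\Omega)$ be its subdifferential, i.e. the set of all $\lambda\in L^\infty(\Omega)$ with $\int_\Omega\lambda\,(w-\bar z)\,dx\le\psi(w)-\psi(\bar z)$ for all $w\in L^1(\Omega)$. Then a pair $(\bar u,\bar z)\in\mathbb{H}^s(\Omega)\times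 Z_{ad}$ is optimal if and only if $\bar u=\mathbf{S}\bar z$ and there exists $\bar\lambda\in\partial\psi(\bar z)$ such that, with $\bar p=\mathbf{S}^\dagger(\mathbf{S}\bar z-\mathsf{u}_d)$, $$(\bar p+\sigma\bar z+\nu\bar\lambda,\ z-\bar z)_{L^2(\Omega)}\ge 0\qquad\text{for all } z\in Z_{ad}.$$ -/

import Mathlib

open MeasureTheory TopologicalSpace
open scoped ENNReal NNReal RealInnerProductSpace Distributions Gradient

noncomputable section

namespace FracControl

/-- A nonempty, bounded, open, convex polytopal subset of `ℝⁿ`: the nonempty interior of the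
convex hull of finitely many points. -/
structure ConvexPolytope (n : ℕ) where
  carrier : Opens (EuclideanSpace ℝ (Fin n))
  exists_vertices : ∃ t : Finset (EuclideanSpace ℝ (Fin n)),
    (carrier : Set (EuclideanSpace ℝ (Fin n))) =
      interior (convexHull ℝ (t : Set (EuclideanSpace ℝ (Fin n))))
  nonempty : (carrier : Set (EuclideanSpace ℝ (Fin n))).Nonempty

variable {n : ℕ}

/-- Lebesgue measure on the domain. -/
abbrev ConvexPolytope.measure (Ω : ConvexPolytope n) : Measure (EuclideanSpace ℝ (Fin n)) :=
  volume.restrict (Ω.carrier : Set (EuclideanSpace ℝ (Fin n)))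

instance ConvexPolytope.isFiniteMeasure (Ω : ConvexPolytope n) : IsFiniteMeasure Ω.measure := by
  obtain ⟨t, ht⟩ := Ω.exists_vertices
  refine isFiniteMeasure_restrict.2 (ne_of_lt ?_)
  rw [ht]
  exact (measure_mono interior_subset).trans_lt
    (t.finite_toSet.isCompact_convexHull (𝕜 := ℝ)).measure_lt_top

/-- `L²(Ω)`. -/
abbrev L2 (Ω : ConvexPolytope n) : Type := Lp ℝ 2 Ω.measure

/-- `L²(Ω; ℝⁿ)`. -/
abbrev L2V (Ω : ConvexPolytope n) : Type := Lp (EuclideanSpace ℝ (Fin n)) 2 Ω.measure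

/-- The inclusion `L^p(Ω) ⊆ L^q(Ω)` for `q ≤ p` (the domain is bounded). -/
def lpIncl {Ω : ConvexPolytope n} {p : ℝ≥0∞} (q : ℝ≥0∞) (h : q ≤ p) (f : Lp ℝ p Ω.measure) :
    Lp ℝ q Ω.measure :=
  ((Lp.memLp f).mono_exponent h).toLp f

/-! ### The operator `w ↦ -div (A ∇w) + c w` with homogeneous Dirichlet conditions -/

/-- Assumptions on the coefficients: `A` is Lipschitz on `Ω`, symmetric and uniformly positive
definite, and `0 ≤ c ∈ L^∞(Ω)`. -/
structure IsEllipticCoeff (Ω : ConvexPolytope n)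
    (A : EuclideanSpace ℝ (Fin n) → Matrix (Fin n) (Fin n) ℝ)
    (c : EuclideanSpace ℝ (Fin n) → ℝ) : Prop where
  lipschitz : ∀ i j, ∃ K : ℝ≥0, LipschitzOnWith K (fun x => A x i j) Ω.carrier
  symm : ∀ x ∈ Ω.carrier, (A x).IsSymm
  elliptic : ∃ α : ℝ, 0 < α ∧ ∀ x ∈ Ω.carrier, ∀ ξ : EuclideanSpace ℝ (Fin n),
    α * ‖ξ‖ ^ 2 ≤ ⟪(A x).toEuclideanLin ξ, ξ⟫
  c_memLp : MemLp c ∞ Ω.measure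
  c_nonneg : ∀ᵐ x ∂Ω.measure, 0 ≤ c x

theorem memLp_testFunction (Ω : ConvexPolytope n) (φ : 𝓓(Ω.carrier, ℝ)) :
    MemLp (φ : EuclideanSpace ℝ (Fin n) → ℝ) 2 Ω.measure :=
  φ.continuous.memLp_of_hasCompactSupport φ.hasCompactSupport

theorem memLp_gradient_testFunction (Ω : ConvexPolytope n) (φ : 𝓓(Ω.carrier, ℝ)) :
    MemLp (∇ (φ : EuclideanSpace ℝ (Fin n) → ℝ)) 2 Ω.measure := by
  have h1 : Continuous (∇ (φ : EuclideanSpace ℝ (Fin n) → ℝ)) :=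
    (InnerProductSpace.toDual ℝ (EuclideanSpace ℝ (Fin n))).symm.continuous.comp
      (φ.contDiff.continuous_fderiv (by simp))
  have h2 : HasCompactSupport (∇ (φ : EuclideanSpace ℝ (Fin n) → ℝ)) :=
    (φ.hasCompactSupport.fderiv (𝕜 := ℝ)).comp_left
      (g := (InnerProductSpace.toDual ℝ (EuclideanSpace ℝ (Fin n))).symm) (map_zero _)
  exact h1.memLp_of_hasCompactSupport h2

/-- The space `H₀¹(Ω)`, the closure of `C_c^∞(Ω)` in the `H¹` norm. An element `w` is recorded
as the pair `(w, ∇w)` in `L²(Ω) × L²(Ω; ℝⁿ)`. -/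
def H10 (Ω : ConvexPolytope n) : Set (L2 Ω × L2V Ω) :=
  closure (Set.range fun φ : 𝓓(Ω.carrier, ℝ) =>
    ((memLp_testFunction Ω φ).toLp φ, (memLp_gradient_testFunction Ω φ).toLp (∇ φ)))

/-- The bilinear form `∫_Ω A ∇v · ∇w + c v w`, evaluated at `(v, ∇v)` and `(w, ∇w)`. -/
def energyForm (Ω : ConvexPolytope n) (A : EuclideanSpace ℝ (Fin n) → Matrix (Fin n) (Fin n) ℝ)
    (c : EuclideanSpace ℝ (Fin n) → ℝ) (v w : L2 Ω × L2V Ω) : ℝ :=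
  ∫ x, (⟪(A x).toEuclideanLin (v.2 x), w.2 x⟫ + c x * v.1 x * w.1 x) ∂Ω.measure

/-- `φ ∈ H₀¹(Ω)` is a weak solution of `-div (A ∇φ) + c φ = lam φ` in `Ω`, `φ = 0` on `∂Ω`
(`φ = 0` is allowed). -/
def IsEigenfunction (Ω : ConvexPolytope n)
    (A : EuclideanSpace ℝ (Fin n) → Matrix (Fin n) (Fin n) ℝ)
    (c : EuclideanSpace ℝ (Fin n) → ℝ) (lam : ℝ) (φ : L2 Ω) : Prop :=
  ∃ g : L2V Ω, (φ, g) ∈ H10 Ω ∧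
    ∀ w ∈ H10 Ω, energyForm Ω A c (φ, g) w = lam * ⟪φ, w.1⟫

/-- The eigenspace for `lam` as a closed subspace of `L²(Ω)`. (The set of eigenfunctions already
is a closed subspace; taking the closed span changes nothing.) It is zero unless `lam` is an
eigenvalue. -/
def eigenspace (Ω : ConvexPolytope n)
    (A : EuclideanSpace ℝ (Fin n) → Matrix (Fin n) (Fin n) ℝ)
    (c : EuclideanSpace ℝ (Fin n) → ℝ) (lam : ℝ) : Submodule ℝ (L2 Ω) :=
  (Submodule.span ℝ {φ | IsEigenfunction Ω A c lam φ}).topologicalClosure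

instance eigenspace_completeSpace (Ω : ConvexPolytope n)
    (A : EuclideanSpace ℝ (Fin n) → Matrix (Fin n) (Fin n) ℝ)
    (c : EuclideanSpace ℝ (Fin n) → ℝ) (lam : ℝ) : CompleteSpace (eigenspace Ω A c lam) :=
  inferInstanceAs (CompleteSpace (Submodule.topologicalClosure _))

/-- The component of `w` in the eigenspace for `lam`. In terms of an orthonormal basis `φ_k` of
eigenfunctions with eigenvalues `λ_k` it is the sum of `(w, φ_k) φ_k` over all `k` with
`λ_k = lam`. -/
def component (Ω : ConvexPolytope n)
    (A : EuclideanSpace ℝ (Fin n) → Matrix (Fin n) (Fin n) ℝ)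
    (c : EuclideanSpace ℝ (Fin n) → ℝ) (lam : ℝ) (w : L2 Ω) : L2 Ω :=
  (eigenspace Ω A c lam).starProjection w

/-- The space `ℍ^s(Ω)` of all `w = ∑ w_k φ_k ∈ L²(Ω)` with `∑ λ_k^s |w_k|² < ∞`; terms with the
same eigenvalue are grouped together. -/
def Hs (Ω : ConvexPolytope n) (A : EuclideanSpace ℝ (Fin n) → Matrix (Fin n) (Fin n) ℝ)
    (c : EuclideanSpace ℝ (Fin n) → ℝ) (s : ℝ) : Set (L2 Ω) :=
  {w | HasSum (fun lam : ℝ => component Ω A c lam w) w ∧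
    Summable fun lam : ℝ => lam ^ s * ‖component Ω A c lam w‖ ^ 2}

/-- The duality pairing `⟨𝓛^s v, w⟩ = ∑ λ_k^s v_k w_k` for `v, w ∈ ℍ^s(Ω)`, grouped by
eigenvalue. -/
def fracPairing (Ω : ConvexPolytope n) (A : EuclideanSpace ℝ (Fin n) → Matrix (Fin n) (Fin n) ℝ)
    (c : EuclideanSpace ℝ (Fin n) → ℝ) (s : ℝ) (v w : L2 Ω) : ℝ :=
  ∑' lam : ℝ, lam ^ s * ⟪component Ω A c lam v, component Ω A c lam w⟫

/-- `u ∈ ℍ^s(Ω)` solves the state equation `𝓛^s u = z`, an identity in the dual of `ℍ^s(Ω)`. -/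
def SolvesState (Ω : ConvexPolytope n)
    (A : EuclideanSpace ℝ (Fin n) → Matrix (Fin n) (Fin n) ℝ)
    (c : EuclideanSpace ℝ (Fin n) → ℝ) (s : ℝ) (u z : L2 Ω) : Prop :=
  u ∈ Hs Ω A c s ∧ ∀ w ∈ Hs Ω A c s, fracPairing Ω A c s u w = ⟪z, w⟫

/-! ### The optimal control problem -/

/-- The function `ψ(z) = ‖z‖_{L¹(Ω)}` on `L¹(Ω)`. -/
def psi (Ω : ConvexPolytope n) (z : Lp ℝ 1 Ω.measure) : ℝ := ‖z‖

/-- The cost functional `½ ‖u - u_d‖² + σ/2 ‖z‖² + ν ‖z‖_{L¹(Ω)}`. -/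
def cost (Ω : ConvexPolytope n) (ud : L2 Ω) (σ ν : ℝ) (u z : L2 Ω) : ℝ :=
  1 / 2 * ‖u - ud‖ ^ 2 + σ / 2 * ‖z‖ ^ 2 + ν * psi Ω (lpIncl 1 one_le_two z)

/-- The set of admissible controls. -/
def Zad (Ω : ConvexPolytope n) (a b : ℝ) : Set (L2 Ω) :=
  {z | ∀ᵐ x ∂Ω.measure, a ≤ z x ∧ z x ≤ b}

/-- `(u, z)` is an optimal state-control pair. -/
def IsOptimalPair (Ω : ConvexPolytope n)
    (A : EuclideanSpace ℝ (Fin n) → Matrix (Fin n) (Fin n) ℝ)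
    (c : EuclideanSpace ℝ (Fin n) → ℝ) (s : ℝ) (ud : L2 Ω) (σ ν a b : ℝ) (u z : L2 Ω) : Prop :=
  u ∈ Hs Ω A c s ∧ z ∈ Zad Ω a b ∧ SolvesState Ω A c s u z ∧
    ∀ u' ∈ Hs Ω A c s, ∀ z' ∈ Zad Ω a b, SolvesState Ω A c s u' z' →
      cost Ω ud σ ν u z ≤ cost Ω ud σ ν u' z'

/-- The subdifferential of a real function on a real normed space. -/
def subdifferential {E : Type*} [NormedAddCommGroup E] [NormedSpace ℝ E] (η : E → ℝ) (v : E) :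
    Set (StrongDual ℝ E) :=
  {l | ∀ w : E, l (w - v) ≤ η w - η v}

/-- The functional `w ↦ ∫_Ω l w` on `L¹(Ω)` given by `l ∈ L^∞(Ω)`. -/
def linftyFunctional (Ω : ConvexPolytope n) (l : Lp ℝ ∞ Ω.measure) :
    StrongDual ℝ (Lp ℝ 1 Ω.measure) :=
  (ContinuousLinearMap.mul ℝ ℝ).lpPairing Ω.measure ∞ 1 l

end FracControl

end

/-! The proof has two independent halves, joined by a solution operator `S`.

Optimality. In terms of `z` alone the cost is a quadratic functional with gradient `q = S†(S z - ud)
+ σ z`, plus `ν` times the L¹ norm. Its Taylor expansion is exact with nonnegative remainder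
(`cost_expansion`), so the subgradient condition implies minimality. Conversely, moving along
segments in the convex admissible set and bounding the L¹ norm by its chord gives `0 ≤ ⟪q, w - z⟫ +
ν (ψ w - ψ z)`. The multiplier is then built pointwise, with no sum rule for subdifferentials.
Comparison with a measurable pointwise minimizer of `q(x) t + ν |t|` on `[a, b]` shows that `z(x)`
is itself such a minimizer almost everywhere. Where `z(x) ≠ 0` the multiplier must be the sign of
`z(x)`; where `z(x) = 0`, the point `0` is interior to `[a, b]`, so `|q(x)| ≤ ν` and `-q(x)/ν`
serves.

State equation. `S` multiplies the component at eigenvalue `lam` by `lam ^ (-s)`. It is bounded and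
solves the equation once the eigenspaces form a Hilbert sum and the eigenvalues stay above a
positive constant. Both facts come from the estimate of `φ(x + h) - φ(x)` in L² by `‖h‖` times the
gradient norm: a long translation yields Poincaré, hence coercivity, and short translations yield
Rellich, hence a compact symmetric inverse to which the spectral theorem applies. -/

namespace FracControl

/-! ### Diagonal operators on Hilbert sums -/

section HilbertSum

variable {ι E : Type*} [NormedAddCommGroup E] [InnerProductSpace ℝ E] [CompleteSpace E]
  {V : ι → Submodule ℝ E} [∀ i, CompleteSpace (V i)]

omit [CompleteSpace E] in
theorem starProjection_eq_zero_of_orthogonalFamily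
    (hV : OrthogonalFamily ℝ (fun i => V i) fun i => (V i).subtypeₗᵢ) {i j : ι} (hij : i ≠ j)
    {x : E} (hx : x ∈ V i) : (V j).starProjection x = 0 := by
  rw [Submodule.starProjection_apply_eq_zero_iff, Submodule.mem_orthogonal]
  intro y hy
  exact hV hij.symm ⟨y, hy⟩ ⟨x, hx⟩

/-- Projecting the expansion of `z` onto `V j` kills every term but one. Parseval's identity for
abstract ℓ² coordinates thereby becomes a statement about the projections that define `component`.
-/
theorem starProjection_linearIsometryEquiv
    (hV : IsHilbertSum ℝ (fun i => V i) fun i => (V i).subtypeₗᵢ) (z : E) (j : ι) :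
    (hV.linearIsometryEquiv z j : E) = (V j).starProjection z := by
  have h := hV.hasSum_linearIsometryEquiv_symm (hV.linearIsometryEquiv z)
  rw [LinearIsometryEquiv.symm_apply_apply] at h
  have h2 := h.mapL (V j).starProjection
  have h3 := hasSum_single (f := fun i => (V j).starProjection
    ((V i).subtypeₗᵢ (hV.linearIsometryEquiv z i))) j (fun i hi =>
      starProjection_eq_zero_of_orthogonalFamily hV.OrthogonalFamily hi (SetLike.coe_mem _))
  rw [h2.unique h3]
  exact (Submodule.starProjection_eq_self_iff.2 (SetLike.coe_mem _)).symm

theorem hasSum_starProjection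
    (hV : IsHilbertSum ℝ (fun i => V i) fun i => (V i).subtypeₗᵢ) (z : E) :
    HasSum (fun i => (V i).starProjection z) z := by
  have h := hV.hasSum_linearIsometryEquiv_symm (hV.linearIsometryEquiv z)
  rw [LinearIsometryEquiv.symm_apply_apply] at h
  simpa [starProjection_linearIsometryEquiv hV z] using h

theorem hasSum_inner_starProjection
    (hV : IsHilbertSum ℝ (fun i => V i) fun i => (V i).subtypeₗᵢ) (z w : E) :
    HasSum (fun i => ⟪(V i).starProjection z, (V i).starProjection w⟫) ⟪z, w⟫ := by
  have h := lp.hasSum_inner (𝕜 := ℝ) (hV.linearIsometryEquiv z) (hV.linearIsometryEquiv w)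
  rw [LinearIsometryEquiv.inner_map_map] at h
  simpa [← starProjection_linearIsometryEquiv hV] using h

theorem hasSum_sq_norm_starProjection
    (hV : IsHilbertSum ℝ (fun i => V i) fun i => (V i).subtypeₗᵢ) (z : E) :
    HasSum (fun i => ‖(V i).starProjection z‖ ^ 2) (‖z‖ ^ 2) := by
  simpa only [real_inner_self_eq_norm_sq] using hasSum_inner_starProjection hV z z

/-- A bounded diagonal operator with respect to a Hilbert sum. -/
theorem exists_diagonal_operator
    (hV : IsHilbertSum ℝ (fun i => V i) fun i => (V i).subtypeₗᵢ) (m : ι → ℝ) (C : ℝ)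
    (hm : ∀ i, V i ≠ ⊥ → |m i| ≤ C) :
    ∃ S : E →L[ℝ] E, ∀ z i, (V i).starProjection (S z) = m i • (V i).starProjection z := by
  have hbound (z : E) (i : ι) :
      ‖m i • (V i).starProjection z‖ ^ 2 ≤ C ^ 2 * ‖(V i).starProjection z‖ ^ 2 := by
    rw [norm_smul, mul_pow, Real.norm_eq_abs]
    by_cases h : V i = ⊥
    · have : (V i).starProjection z = 0 := by
        have := Submodule.starProjection_apply_mem (V i) z
        exact (Submodule.eq_bot_iff _).1 h _ this
      simp [this]
    · gcongr
      exact hm i h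
  have hsum2 (z : E) : Summable fun i => ‖m i • (V i).starProjection z‖ ^ 2 :=
    ((hasSum_sq_norm_starProjection hV z).summable.mul_left (C ^ 2)).of_nonneg_of_le
      (fun i => by positivity) (hbound z)
  have hsum (z : E) : Summable fun i => m i • (V i).starProjection z :=
    (hV.OrthogonalFamily.summable_iff_norm_sq_summable
      fun i => m i • (V i).orthogonalProjectionOnto z).2 (hsum2 z)
  let S : E →ₗ[ℝ] E :=
    { toFun := fun z => ∑' i, m i • (V i).starProjection z
      map_add' := fun x y => by
        rw [← (hsum x).tsum_add (hsum y)]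
        simp [smul_add]
      map_smul' := fun r x => by
        rw [RingHom.id_apply, ← (hsum x).tsum_const_smul r]
        simp [smul_comm r] }
  have hS (z : E) (j : ι) : (V j).starProjection (S z) = m j • (V j).starProjection z := by
    have h2 := (hsum z).hasSum.mapL (V j).starProjection
    have h3 := hasSum_single (f := fun i => (V j).starProjection
      (m i • (V i).starProjection z)) j (fun i hi =>
        starProjection_eq_zero_of_orthogonalFamily hV.OrthogonalFamily hi
          ((V i).smul_mem _ (Submodule.starProjection_apply_mem _ _)))
    refine (h2.unique h3).trans (Submodule.starProjection_eq_self_iff.2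
      ((V j).smul_mem _ (Submodule.starProjection_apply_mem _ _)))
  -- `C` may be negative when every `V i` is trivial, hence the absolute value.
  refine ⟨S.mkContinuous |C| fun z => ?_, fun z i => hS z i⟩
  refine le_of_sq_le_sq ?_ (by positivity)
  rw [mul_pow, sq_abs]
  refine hasSum_le (fun i => ?_) (hasSum_sq_norm_starProjection hV (S z))
    ((hasSum_sq_norm_starProjection hV z).mul_left (C ^ 2))
  rw [hS]
  exact hbound z i

end HilbertSum

/-! ### The fractional state equation -/

variable {n : ℕ}

/-- The spectral solution operator of the fractional state equation. -/
theorem exists_state_operator {Ω : ConvexPolytope n}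
    {A : EuclideanSpace ℝ (Fin n) → Matrix (Fin n) (Fin n) ℝ} {c : EuclideanSpace ℝ (Fin n) → ℝ}
    (hV : IsHilbertSum ℝ (fun lam => eigenspace Ω A c lam)
      fun lam => (eigenspace Ω A c lam).subtypeₗᵢ)
    {l₀ : ℝ} (hl₀ : 0 < l₀) (hl : ∀ lam, eigenspace Ω A c lam ≠ ⊥ → l₀ ≤ lam)
    {s : ℝ} (hs : 0 < s) :
    ∃ S : L2 Ω →L[ℝ] L2 Ω, ∀ z u, SolvesState Ω A c s u z ↔ u = S z := by
  have hbot (lam : ℝ) (h : eigenspace Ω A c lam = ⊥) (z : L2 Ω) : component Ω A c lam z = 0 :=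
    (Submodule.eq_bot_iff _).1 h _ (Submodule.starProjection_apply_mem _ z)
  have hinv (lam : ℝ) (h : eigenspace Ω A c lam ≠ ⊥) : 0 < lam := hl₀.trans_le (hl lam h)
  have hm (lam : ℝ) (h : eigenspace Ω A c lam ≠ ⊥) : |lam ^ (-s)| ≤ l₀ ^ (-s) := by
    rw [abs_of_nonneg (Real.rpow_nonneg (hinv lam h).le _)]
    exact Real.rpow_le_rpow_of_nonpos hl₀ (hl lam h) (by linarith)
  obtain ⟨S, hS⟩ := exists_diagonal_operator hV (fun lam : ℝ => lam ^ (-s)) (l₀ ^ (-s)) hm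
  have hS' (z : L2 Ω) (lam : ℝ) :
      component Ω A c lam (S z) = lam ^ (-s) • component Ω A c lam z := hS z lam
  have hcancel (z : L2 Ω) (lam : ℝ) :
      lam ^ s • component Ω A c lam (S z) = component Ω A c lam z := by
    by_cases h : eigenspace Ω A c lam = ⊥
    · simp [hbot lam h]
    · rw [hS', smul_smul, ← Real.rpow_add (hinv lam h)]
      simp
  refine ⟨S, fun z u => ⟨fun ⟨_, h⟩ => ?_, ?_⟩⟩
  · have key (lam : ℝ) : component Ω A c lam u = component Ω A c lam (S z) := by
      by_cases hb : eigenspace Ω A c lam = ⊥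
      · rw [hbot lam hb, hbot lam hb]
      have hpos : 0 < lam ^ s := Real.rpow_pos_of_pos (hinv lam hb) s
      refine (smul_right_injective _ hpos.ne') ?_
      change lam ^ s • component Ω A c lam u = lam ^ s • component Ω A c lam (S z)
      rw [hcancel]
      refine ext_inner_right ℝ fun v => ?_
      -- A test function lying in one eigenspace reduces the pairing to a single term and isolates
      -- the component of `u` at `lam`.
      set w : L2 Ω := component Ω A c lam v with hw
      have hwmem : w ∈ eigenspace Ω A c lam := Submodule.starProjection_apply_mem _ v
      have hne (mu : ℝ) (hmu : mu ≠ lam) : component Ω A c mu w = 0 :=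
        starProjection_eq_zero_of_orthogonalFamily hV.OrthogonalFamily hmu.symm hwmem
      have hww : component Ω A c lam w = w := Submodule.starProjection_eq_self_iff.2 hwmem
      have hmove (y : L2 Ω) : ⟪component Ω A c lam y, v⟫ = ⟪y, w⟫ :=
        Submodule.inner_starProjection_left_eq_right _ _ _
      have hwHs : w ∈ Hs Ω A c s := by
        refine ⟨hasSum_starProjection hV w, ?_⟩
        refine summable_of_ne_finset_zero (s := {lam}) fun mu hmu => ?_
        rw [hne mu (by simpa using hmu)]
        simp
      have h2 := h w hwHs
      rw [fracPairing, tsum_eq_single lam (fun mu hmu => by rw [hne mu hmu]; simp), hww,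
        ← hmove z] at h2
      have hidem : component Ω A c lam (component Ω A c lam u) = component Ω A c lam u :=
        Submodule.starProjection_eq_self_iff.2 (Submodule.starProjection_apply_mem _ u)
      rw [← h2, inner_smul_left, ← hmove, hidem]
      simp
    exact (hasSum_starProjection hV u).unique
      ((hasSum_starProjection hV (S z)).congr_fun key)
  · rintro rfl
    refine ⟨⟨hasSum_starProjection hV _, ?_⟩, fun w _ => ?_⟩
    -- By `hcancel`, `lam ^ s` times the squared norm of the component of `S z` is the inner product
    -- of the components of `z` and `S z`, summable by Parseval.
    · have h1 := (hasSum_inner_starProjection hV z (S z)).summable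
      refine h1.congr fun lam => ?_
      change ⟪component Ω A c lam z, component Ω A c lam (S z)⟫ = _
      rw [← real_inner_self_eq_norm_sq, ← hcancel z lam, inner_smul_left]
      simp
    · have h1 := (hasSum_inner_starProjection hV z w)
      rw [fracPairing, ← h1.tsum_eq]
      refine tsum_congr fun lam => ?_
      change _ = ⟪component Ω A c lam z, component Ω A c lam w⟫
      rw [← hcancel z lam, inner_smul_left]
      simp

/-! ### The reduced cost functional -/

theorem coeFn_lpIncl {Ω : ConvexPolytope n} {p q : ℝ≥0∞} (h : q ≤ p) (f : Lp ℝ p Ω.measure) :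
    lpIncl q h f =ᵐ[Ω.measure] f :=
  MemLp.coeFn_toLp _

theorem psi_lpIncl {Ω : ConvexPolytope n} (z : L2 Ω) :
    psi Ω (lpIncl 1 one_le_two z) = ∫ x, |z x| ∂Ω.measure := by
  rw [psi, L1.norm_eq_integral_norm]
  refine integral_congr_ae ?_
  filter_upwards [coeFn_lpIncl one_le_two z] with x hx
  rw [hx, Real.norm_eq_abs]

theorem integrable_L2 {Ω : ConvexPolytope n} (z : L2 Ω) : Integrable z Ω.measure :=
  (Lp.memLp z).integrable one_le_two

theorem inner_L2 {Ω : ConvexPolytope n} (f g : L2 Ω) : ⟪f, g⟫ = ∫ x, f x * g x ∂Ω.measure := by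
  rw [L2.inner_def]
  simp [mul_comm]

theorem integrable_mul_L2 {Ω : ConvexPolytope n} (f g : L2 Ω) :
    Integrable (fun x => f x * g x) Ω.measure := by
  simpa [mul_comm] using L2.integrable_inner (𝕜 := ℝ) f g

theorem psi_convex_combination {Ω : ConvexPolytope n} (z w : L2 Ω) {t : ℝ} (h0 : 0 ≤ t)
    (h1 : t ≤ 1) :
    psi Ω (lpIncl 1 one_le_two (z + t • (w - z))) ≤
      psi Ω (lpIncl 1 one_le_two z) +
        t * (psi Ω (lpIncl 1 one_le_two w) - psi Ω (lpIncl 1 one_le_two z)) := by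
  simp only [psi_lpIncl]
  have hi : Integrable (fun x => t * (|w x| - |z x|)) Ω.measure :=
    ((integrable_L2 w).abs.sub (integrable_L2 z).abs).const_mul t
  rw [← integral_sub (integrable_L2 w).abs (integrable_L2 z).abs, ← integral_const_mul,
    ← integral_add (integrable_L2 z).abs hi]
  refine integral_mono_ae (integrable_L2 _).abs ((integrable_L2 z).abs.add hi) ?_
  filter_upwards [Lp.coeFn_add z (t • (w - z)), Lp.coeFn_smul t (w - z), Lp.coeFn_sub w z]
    with x e1 e2 e3
  simp only [e1, Pi.add_apply, e2, Pi.smul_apply, e3, Pi.sub_apply, smul_eq_mul]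
  rw [show z x + t * (w x - z x) = (1 - t) * z x + t * w x by ring]
  refine (abs_add_le _ _).trans ?_
  rw [abs_mul, abs_mul, abs_of_nonneg h0, abs_of_nonneg (by linarith : (0 : ℝ) ≤ 1 - t)]
  apply le_of_eq
  ring

theorem Zad_convex_combination {Ω : ConvexPolytope n} {a b : ℝ} {z w : L2 Ω}
    (hz : z ∈ Zad Ω a b) (hw : w ∈ Zad Ω a b) {t : ℝ} (h0 : 0 ≤ t) (h1 : t ≤ 1) :
    z + t • (w - z) ∈ Zad Ω a b := by
  simp only [Zad, Set.mem_ofPred_eq] at hz hw ⊢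
  filter_upwards [hz, hw, Lp.coeFn_add z (t • (w - z)), Lp.coeFn_smul t (w - z), Lp.coeFn_sub w z]
    with x hz hw e1 e2 e3
  simp only [e1, Pi.add_apply, e2, Pi.smul_apply, e3, Pi.sub_apply, smul_eq_mul]
  constructor <;> nlinarith

/-- The gradient of the smooth part of the reduced cost functional. -/
noncomputable def reducedGradient {Ω : ConvexPolytope n} (S : L2 Ω →L[ℝ] L2 Ω) (ud : L2 Ω) (σ : ℝ) (z : L2 Ω) :
    L2 Ω :=
  ContinuousLinearMap.adjoint S (S z - ud) + σ • z

theorem cost_expansion {Ω : ConvexPolytope n} (S : L2 Ω →L[ℝ] L2 Ω) (ud : L2 Ω) (σ ν : ℝ)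
    (z h : L2 Ω) :
    cost Ω ud σ ν (S (z + h)) (z + h) = cost Ω ud σ ν (S z) z + ⟪reducedGradient S ud σ z, h⟫ +
      (1 / 2 * ‖S h‖ ^ 2 + σ / 2 * ‖h‖ ^ 2) +
      ν * (psi Ω (lpIncl 1 one_le_two (z + h)) - psi Ω (lpIncl 1 one_le_two z)) := by
  have e1 : S (z + h) - ud = (S z - ud) + S h := by rw [map_add]; abel
  rw [cost, cost, e1, norm_add_sq_real, norm_add_sq_real, reducedGradient, inner_add_left,
    ContinuousLinearMap.adjoint_inner_left, inner_smul_left]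
  simp only [RCLike.conj_to_real]
  ring

/-- Minimality along the segment from `z` to `w`, divided by the step `t`, leaves a remainder of
order `t` that vanishes as `t → 0`. Convexity replaces differentiation of the L¹ norm. -/
theorem variational_inequality_of_isMin {Ω : ConvexPolytope n} (S : L2 Ω →L[ℝ] L2 Ω) (ud : L2 Ω)
    {σ ν : ℝ} (hν : 0 < ν) {a b : ℝ} {z : L2 Ω} (hz : z ∈ Zad Ω a b)
    (hmin : ∀ w ∈ Zad Ω a b, cost Ω ud σ ν (S z) z ≤ cost Ω ud σ ν (S w) w)
    {w : L2 Ω} (hw : w ∈ Zad Ω a b) :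
    0 ≤ ⟪reducedGradient S ud σ z, w - z⟫ +
      ν * (psi Ω (lpIncl 1 one_le_two w) - psi Ω (lpIncl 1 one_le_two z)) := by
  set D := ⟪reducedGradient S ud σ z, w - z⟫ +
      ν * (psi Ω (lpIncl 1 one_le_two w) - psi Ω (lpIncl 1 one_le_two z)) with hD
  set R := 1 / 2 * ‖S (w - z)‖ ^ 2 + σ / 2 * ‖w - z‖ ^ 2 with hR
  have key (t : ℝ) (h0 : 0 < t) (h1 : t ≤ 1) : 0 ≤ D + t * R := by
    have h2 := hmin _ (Zad_convex_combination hz hw h0.le h1)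
    rw [cost_expansion, map_smul, norm_smul, norm_smul, inner_smul_right, mul_pow, mul_pow,
      Real.norm_eq_abs, sq_abs] at h2
    have h3 := mul_le_mul_of_nonneg_left (psi_convex_combination z w h0.le h1) hν.le
    refine nonneg_of_mul_nonneg_right (a := t) ?_ h0
    rw [hD, hR]
    linarith
  have hlim : Filter.Tendsto (fun t : ℝ => D + t * R) (nhdsWithin 0 (Set.Ioi 0)) (nhds D) := by
    have : Continuous fun t : ℝ => D + t * R := by fun_prop
    simpa using (this.tendsto 0).mono_left nhdsWithin_le_nhds
  refine ge_of_tendsto hlim ?_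
  filter_upwards [Ioc_mem_nhdsGT (zero_lt_one' ℝ)] with t ht
  exact key t ht.1 ht.2

/-! ### The scalar problem and the multiplier -/

/-- A minimizer of `t ↦ q t + ν |t|` on `[a, b]`. -/
noncomputable def scalarMinimizer (ν a b q : ℝ) : ℝ := if ν < q then a else if q < -ν then b else 0

theorem scalarMinimizer_mem {ν a b : ℝ} (ha : a < 0) (hb : 0 < b) (q : ℝ) :
    a ≤ scalarMinimizer ν a b q ∧ scalarMinimizer ν a b q ≤ b := by
  unfold scalarMinimizer
  split_ifs <;> constructor <;> linarith

/-- The slopes are `q - ν` left of `0` and `q + ν` right of it. They are both positive if `q > ν`,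
both negative if `q < -ν`, and otherwise the function is nonnegative and vanishes at `0`. -/
theorem scalarMinimizer_le {ν a b : ℝ} (hν : 0 < ν) (ha : a < 0) (hb : 0 < b) (q : ℝ) {t : ℝ}
    (h1 : a ≤ t) (h2 : t ≤ b) :
    q * scalarMinimizer ν a b q + ν * |scalarMinimizer ν a b q| ≤ q * t + ν * |t| := by
  unfold scalarMinimizer
  split_ifs with h h'
  · rw [abs_of_neg ha]
    nlinarith [mul_nonneg (sub_nonneg.2 h1) (sub_nonneg.2 h.le),
      mul_le_mul_of_nonneg_left (neg_le_abs t) hν.le]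
  · rw [abs_of_pos hb]
    nlinarith [mul_nonneg (sub_nonneg.2 h2) (by linarith : 0 ≤ -ν - q),
      mul_le_mul_of_nonneg_left (le_abs_self t) hν.le]
  · simp only [abs_zero, mul_zero, add_zero]
    have hq : |q| ≤ ν := abs_le.2 ⟨not_lt.1 h', not_lt.1 h⟩
    have := mul_le_mul_of_nonneg_right hq (abs_nonneg t)
    rw [← abs_mul] at this
    linarith [neg_abs_le (q * t)]

theorem measurable_scalarMinimizer (ν a b : ℝ) : Measurable (scalarMinimizer ν a b) :=
  Measurable.ite measurableSet_Ioi measurable_const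
    (Measurable.ite measurableSet_Iio measurable_const measurable_const)

/-- A subgradient of the absolute value at `t`, adapted to the slope `q` when `t = 0`. -/
noncomputable def scalarSubgradient (ν q t : ℝ) : ℝ :=
  if 0 < t then 1 else if t < 0 then -1 else max (-1) (min 1 (-q / ν))

theorem abs_scalarSubgradient_le (ν q t : ℝ) : |scalarSubgradient ν q t| ≤ 1 := by
  unfold scalarSubgradient
  split_ifs
  · simp
  · simp
  · rw [abs_le]
    exact ⟨le_max_left _ _, max_le (by norm_num) (min_le_left _ _)⟩

theorem scalarSubgradient_mul (ν q t : ℝ) : scalarSubgradient ν q t * t = |t| := by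
  unfold scalarSubgradient
  split_ifs with h1 h2
  · rw [abs_of_pos h1, one_mul]
  · rw [abs_of_neg h2]; ring
  · simp [le_antisymm (not_lt.1 h1) (not_lt.1 h2)]

theorem measurable_scalarSubgradient (ν : ℝ) :
    Measurable fun p : ℝ × ℝ => scalarSubgradient ν p.1 p.2 :=
  Measurable.ite (measurableSet_lt measurable_const measurable_snd) measurable_const
    (Measurable.ite (measurableSet_lt measurable_snd measurable_const) measurable_const
      (measurable_const.max (measurable_const.min (measurable_fst.neg.div_const ν))))

/-- For `t ≠ 0`, comparison with `r = 0` gives the sign of `q ± ν`, which settles `w` on the inner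
side of `t`; comparison with `w` settles the outer side. -/
theorem scalar_variational_inequality {ν a b : ℝ} (hν : 0 < ν) (ha : a < 0) (hb : 0 < b) {q t : ℝ}
    (hmin : ∀ r, a ≤ r → r ≤ b → q * t + ν * |t| ≤ q * r + ν * |r|) {w : ℝ}
    (h1 : a ≤ w) (h2 : w ≤ b) : 0 ≤ (q + ν * scalarSubgradient ν q t) * (w - t) := by
  have hzero := hmin 0 ha.le hb.le
  simp only [abs_zero, mul_zero, add_zero] at hzero
  have hw := hmin w h1 h2
  unfold scalarSubgradient
  split_ifs with h h'
  · rw [abs_of_pos h] at hzero hw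
    rcases le_or_gt w t with hwt | hwt
    · have : q + ν ≤ 0 := by nlinarith
      nlinarith
    · rw [abs_of_pos (h.trans hwt)] at hw
      linarith
  · rw [abs_of_neg h'] at hzero hw
    rcases le_or_gt t w with hwt | hwt
    · have : 0 ≤ q - ν := by nlinarith
      nlinarith
    · rw [abs_of_neg (hwt.trans h')] at hw
      linarith
  · obtain rfl : t = 0 := le_antisymm (not_lt.1 h) (not_lt.1 h')
    have ea := hmin a le_rfl (ha.trans hb).le
    have eb := hmin b (ha.trans hb).le le_rfl
    rw [abs_of_neg ha] at ea
    rw [abs_of_pos hb] at eb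
    simp only [abs_zero, mul_zero, add_zero] at ea eb
    -- Comparison with both endpoints gives `|q| ≤ ν`, so the truncation in `scalarSubgradient` is
    -- inactive and the factor `q + ν * scalarSubgradient ν q 0` vanishes.
    have e1 : q ≤ ν := by nlinarith
    have e2 : -ν ≤ q := by nlinarith
    rw [min_eq_right (by rw [div_le_one hν]; linarith),
      max_eq_right (by rw [le_div_iff₀ hν]; linarith), mul_div_cancel₀ _ hν.ne']
    simp

theorem exists_subgradient_of_variational_inequality {Ω : ConvexPolytope n} {ν : ℝ} (hν : 0 < ν)
    {a b : ℝ} (ha : a < 0) (hb : 0 < b) (q : L2 Ω) {z : L2 Ω} (hz : z ∈ Zad Ω a b)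
    (h : ∀ w ∈ Zad Ω a b, 0 ≤ ⟪q, w - z⟫ +
      ν * (psi Ω (lpIncl 1 one_le_two w) - psi Ω (lpIncl 1 one_le_two z))) :
    ∃ l : Lp ℝ ∞ Ω.measure,
      linftyFunctional Ω l ∈ subdifferential (psi Ω) (lpIncl 1 one_le_two z) ∧
      ∀ w ∈ Zad Ω a b, 0 ≤ ⟪q + ν • lpIncl 2 le_top l, w - z⟫ := by
  have hqm : Measurable q := (Lp.stronglyMeasurable q).measurable
  have hzm : Measurable z := (Lp.stronglyMeasurable z).measurable
  have hpoint : ∀ᵐ x ∂Ω.measure, ∀ r, a ≤ r → r ≤ b →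
      q x * z x + ν * |z x| ≤ q x * r + ν * |r| := by
    have hmL : MemLp (fun x => scalarMinimizer ν a b (q x)) 2 Ω.measure := by
      refine MemLp.of_bound ((measurable_scalarMinimizer ν a b).comp hqm).aestronglyMeasurable
        (max |a| |b|) (Filter.Eventually.of_forall fun x => ?_)
      exact abs_le_max_abs_abs (scalarMinimizer_mem ha hb _).1 (scalarMinimizer_mem ha hb _).2
    set m : L2 Ω := hmL.toLp with hm
    have hme : m =ᵐ[Ω.measure] fun x => scalarMinimizer ν a b (q x) := hmL.coeFn_toLp
    have hmZ : m ∈ Zad Ω a b := by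
      simp only [Zad, Set.mem_ofPred_eq]
      filter_upwards [hme] with x hx
      rw [hx]
      exact scalarMinimizer_mem ha hb _
    have h2 := h m hmZ
    rw [inner_sub_right, inner_L2, inner_L2, psi_lpIncl, psi_lpIncl] at h2
    have i1 (f : L2 Ω) : Integrable (fun x => q x * f x + ν * |f x|) Ω.measure :=
      (integrable_mul_L2 q f).add ((integrable_L2 f).abs.const_mul ν)
    have i2 (f : L2 Ω) : ∫ x, (q x * f x + ν * |f x|) ∂Ω.measure =
        (∫ x, q x * f x ∂Ω.measure) + ν * ∫ x, |f x| ∂Ω.measure := by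
      rw [integral_add (integrable_mul_L2 q f) ((integrable_L2 f).abs.const_mul ν),
        integral_const_mul]
    -- This difference is nonnegative pointwise by the choice of `m`, while the hypothesis tested
    -- with `m` makes its integral nonpositive. Hence it vanishes almost everywhere.
    have hle : 0 ≤ᵐ[Ω.measure] fun x => (q x * z x + ν * |z x|) - (q x * m x + ν * |m x|) := by
      filter_upwards [hme, hz] with x hx hzx
      rw [hx]
      exact sub_nonneg.2 (scalarMinimizer_le hν ha hb (q x) hzx.1 hzx.2)
    have hint : ∫ x, ((q x * z x + ν * |z x|) - (q x * m x + ν * |m x|)) ∂Ω.measure = 0 := by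
      refine le_antisymm ?_ (integral_nonneg_of_ae hle)
      rw [integral_sub (i1 z) (i1 m), i2, i2]
      linarith
    have hzero := (integral_eq_zero_iff_of_nonneg_ae hle ((i1 z).sub (i1 m))).1 hint
    filter_upwards [hzero, hme] with x hx hmx r h1 h2
    rw [hmx] at hx
    have := scalarMinimizer_le hν ha hb (q x) h1 h2
    simp only [Pi.zero_apply] at hx
    linarith
  have hlL : MemLp (fun x => scalarSubgradient ν (q x) (z x)) ∞ Ω.measure :=
    memLp_top_of_bound ((measurable_scalarSubgradient ν).comp
      (hqm.prodMk hzm)).aestronglyMeasurable 1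
      (Filter.Eventually.of_forall fun x => abs_scalarSubgradient_le _ _ _)
  set l : Lp ℝ ∞ Ω.measure := hlL.toLp with hl
  have hle : l =ᵐ[Ω.measure] fun x => scalarSubgradient ν (q x) (z x) := hlL.coeFn_toLp
  refine ⟨l, fun w => ?_, fun w hw => ?_⟩
  · have hi (f : Lp ℝ 1 Ω.measure) : Integrable f Ω.measure := L1.integrable_coeFn f
    rw [linftyFunctional, ContinuousLinearMap.lpPairing_eq_integral, psi, psi,
      L1.norm_eq_integral_norm, L1.norm_eq_integral_norm, ← integral_sub (hi _).norm (hi _).norm]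
    have hint : Integrable (fun x => scalarSubgradient ν (q x) (z x) *
        (w - lpIncl 1 one_le_two z : Lp ℝ 1 Ω.measure) x) Ω.measure :=
      (hi _).bdd_mul (c := 1) hlL.1
        (Filter.Eventually.of_forall fun x => abs_scalarSubgradient_le _ _ _)
    have e : ∫ x, (ContinuousLinearMap.mul ℝ ℝ) (l x)
        ((w - lpIncl 1 one_le_two z : Lp ℝ 1 Ω.measure) x) ∂Ω.measure =
        ∫ x, scalarSubgradient ν (q x) (z x) *
          (w - lpIncl 1 one_le_two z : Lp ℝ 1 Ω.measure) x ∂Ω.measure := by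
      refine integral_congr_ae ?_
      filter_upwards [hle] with x hx
      rw [hx, ContinuousLinearMap.mul_apply']
    rw [e]
    refine integral_mono_ae hint ((hi _).norm.sub (hi _).norm) ?_
    filter_upwards [Lp.coeFn_sub w (lpIncl 1 one_le_two z), coeFn_lpIncl one_le_two z] with x e1 e2
    rw [e1, Pi.sub_apply, e2, mul_sub, scalarSubgradient_mul, Real.norm_eq_abs, Real.norm_eq_abs]
    gcongr
    refine (le_abs_self _).trans ?_
    rw [abs_mul]
    exact mul_le_of_le_one_left (abs_nonneg _) (abs_scalarSubgradient_le _ _ _)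
  · rw [inner_L2]
    refine integral_nonneg_of_ae ?_
    filter_upwards [hpoint, hle, hw, Lp.coeFn_add q (ν • lpIncl 2 le_top l),
      Lp.coeFn_smul ν (lpIncl 2 le_top l), Lp.coeFn_sub w z,
      coeFn_lpIncl (q := 2) le_top l] with x hp e1 hwx e2 e3 e4 e5
    rw [e2, Pi.add_apply, e3, Pi.smul_apply, e5, e1, e4, Pi.sub_apply, smul_eq_mul]
    exact scalar_variational_inequality hν ha hb hp hwx.1 hwx.2

/-- The subgradient inequality times `ν`, added to the variational inequality, makes the first-order
part of `cost_expansion` nonnegative; the remainder is a sum of squares. -/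
theorem isMin_of_subgradient {Ω : ConvexPolytope n} (S : L2 Ω →L[ℝ] L2 Ω) (ud : L2 Ω)
    {σ ν : ℝ} (hσ : 0 < σ) (hν : 0 < ν) {z w : L2 Ω} {l : Lp ℝ ∞ Ω.measure}
    (hl : linftyFunctional Ω l ∈ subdifferential (psi Ω) (lpIncl 1 one_le_two z))
    (h : 0 ≤ ⟪reducedGradient S ud σ z + ν • lpIncl 2 le_top l, w - z⟫) :
    cost Ω ud σ ν (S z) z ≤ cost Ω ud σ ν (S w) w := by
  have h1 := cost_expansion S ud σ ν z (w - z)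
  rw [add_sub_cancel] at h1
  have h2 := hl (lpIncl 1 one_le_two w)
  have h3 : linftyFunctional Ω l (lpIncl 1 one_le_two w - lpIncl 1 one_le_two z) =
      ⟪lpIncl 2 le_top l, w - z⟫ := by
    rw [linftyFunctional, ContinuousLinearMap.lpPairing_eq_integral, inner_L2]
    refine integral_congr_ae ?_
    filter_upwards [Lp.coeFn_sub (lpIncl 1 one_le_two w) (lpIncl 1 one_le_two z),
      coeFn_lpIncl one_le_two z, coeFn_lpIncl one_le_two w, Lp.coeFn_sub w z,
      coeFn_lpIncl (q := 2) le_top l] with x e1 e2 e3 e4 e5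
    rw [e1, e4, Pi.sub_apply, Pi.sub_apply, e2, e3, e5, ContinuousLinearMap.mul_apply']
  rw [h3] at h2
  rw [inner_add_left, inner_smul_left] at h
  simp only [RCLike.conj_to_real] at h
  have h4 := mul_le_mul_of_nonneg_left h2 hν.le
  have h5 : 0 ≤ 1 / 2 * ‖S (w - z)‖ ^ 2 + σ / 2 * ‖w - z‖ ^ 2 := by positivity
  linarith

theorem isOptimalPair_iff {Ω : ConvexPolytope n}
    {A : EuclideanSpace ℝ (Fin n) → Matrix (Fin n) (Fin n) ℝ} {c : EuclideanSpace ℝ (Fin n) → ℝ}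
    {s σ ν a b : ℝ} (hσ : 0 < σ) (hν : 0 < ν) (ha : a < 0) (hb : 0 < b) (ud : L2 Ω)
    {S : L2 Ω →L[ℝ] L2 Ω} (hS : ∀ z u, SolvesState Ω A c s u z ↔ u = S z) (u : L2 Ω)
    {z : L2 Ω} (hz : z ∈ Zad Ω a b) :
    IsOptimalPair Ω A c s ud σ ν a b u z ↔ u = S z ∧ ∃ l : Lp ℝ ∞ Ω.measure,
      linftyFunctional Ω l ∈ subdifferential (psi Ω) (lpIncl 1 one_le_two z) ∧
      ∀ w ∈ Zad Ω a b,
        0 ≤ ⟪ContinuousLinearMap.adjoint S (S z - ud) + σ • z + ν • lpIncl 2 le_top l, w - z⟫ := by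
  have hsolve (w : L2 Ω) : SolvesState Ω A c s (S w) w := (hS w (S w)).2 rfl
  constructor
  · rintro ⟨-, -, hu, hmin⟩
    obtain rfl := (hS z u).1 hu
    refine ⟨rfl, exists_subgradient_of_variational_inequality hν ha hb
      (reducedGradient S ud σ z) hz fun w hw => variational_inequality_of_isMin S ud hν hz
        (fun w hw => hmin _ (hsolve w).1 w hw (hsolve w)) hw⟩
  · rintro ⟨rfl, l, hl, h⟩
    refine ⟨(hsolve z).1, hz, hsolve z, fun u' _ w hw hu' => ?_⟩
    obtain rfl := (hS w u').1 hu'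
    exact isMin_of_subgradient S ud hσ hν hl (h w hw)

/-! ### Translation estimates and the Poincaré inequality -/

section Translation

theorem eLpNorm_two_sq {α F : Type*} [MeasurableSpace α] [NormedAddCommGroup F]
    (f : α → F) (μ : Measure α) : eLpNorm f 2 μ ^ 2 = ∫⁻ x, ‖f x‖ₑ ^ 2 ∂μ := by
  have h := eLpNorm_nnreal_pow_eq_lintegral (f := f) (μ := μ) (p := 2) two_ne_zero
  simpa only [NNReal.coe_ofNat, ENNReal.coe_ofNat, ENNReal.rpow_ofNat] using h

theorem enorm_integral_sq_le {α F : Type*} [MeasurableSpace α] [NormedAddCommGroup F]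
    [NormedSpace ℝ F] (μ : Measure α) [IsProbabilityMeasure μ] {g : α → F}
    (hg : AEStronglyMeasurable g μ) : ‖∫ x, g x ∂μ‖ₑ ^ 2 ≤ ∫⁻ x, ‖g x‖ₑ ^ 2 ∂μ := by
  rw [← eLpNorm_two_sq]
  gcongr
  refine (enorm_integral_le_lintegral_enorm g).trans ?_
  rw [← eLpNorm_one_eq_lintegral_enorm]
  exact eLpNorm_le_eLpNorm_of_exponent_le one_le_two hg

variable {E : Type*} [NormedAddCommGroup E] [NormedSpace ℝ E] [FiniteDimensional ℝ E]
  [MeasurableSpace E] [BorelSpace E] (μ : Measure E) [μ.IsAddHaarMeasure]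

/-- Write the increment as the integral of the derivative along the segment, apply Jensen, exchange
the integrals and use translation invariance. -/
theorem lintegral_sq_translate_sub_le {φ : E → ℝ} (hφ : ContDiff ℝ 1 φ) (h : E) :
    ∫⁻ x, ‖φ (x + h) - φ x‖ₑ ^ 2 ∂μ ≤ ‖h‖ₑ ^ 2 * ∫⁻ x, ‖fderiv ℝ φ x‖ₑ ^ 2 ∂μ := by
  have hcont : Continuous (fderiv ℝ φ) := hφ.continuous_fderiv (by simp)
  set ρ : Measure ℝ := volume.restrict (Set.Ioc 0 1) with hρ
  have : IsProbabilityMeasure ρ := ⟨by simp [hρ]⟩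
  have hpt (x : E) : ‖φ (x + h) - φ x‖ₑ ^ 2 ≤
      ∫⁻ t, ‖h‖ₑ ^ 2 * ‖fderiv ℝ φ (t • h + x)‖ₑ ^ 2 ∂ρ := by
    have hc : Continuous fun t : ℝ => fderiv ℝ φ (t • h + x) h := by fun_prop
    have hd (t : ℝ) : HasDerivAt (fun t : ℝ => φ (t • h + x)) (fderiv ℝ φ (t • h + x) h) t := by
      have h1 : HasDerivAt (fun t : ℝ => t • h + x) h t := by
        simpa using ((hasDerivAt_id t).smul_const h).add_const x
      exact ((hφ.differentiable (by simp)) _).hasFDerivAt.comp_hasDerivAt t h1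
    have h2 := intervalIntegral.integral_eq_sub_of_hasDerivAt (a := 0) (b := 1)
      (fun t _ => hd t) (hc.intervalIntegrable 0 1)
    rw [intervalIntegral.integral_of_le zero_le_one] at h2
    simp only [one_smul, zero_smul, zero_add] at h2
    rw [add_comm x h, ← h2]
    refine (enorm_integral_sq_le ρ hc.aestronglyMeasurable).trans (lintegral_mono fun t => ?_)
    rw [← mul_pow, mul_comm]
    gcongr
    exact ContinuousLinearMap.le_opENorm _ _
  refine (lintegral_mono hpt).trans ?_
  have hm : Measurable fun p : E × ℝ => ‖h‖ₑ ^ 2 * ‖fderiv ℝ φ (p.2 • h + p.1)‖ₑ ^ 2 := by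
    have : Continuous fun p : E × ℝ => fderiv ℝ φ (p.2 • h + p.1) := by fun_prop
    exact (this.enorm.measurable.pow_const 2).const_mul _
  rw [lintegral_lintegral_swap hm.aemeasurable]
  have hin (t : ℝ) : ∫⁻ x, ‖h‖ₑ ^ 2 * ‖fderiv ℝ φ (t • h + x)‖ₑ ^ 2 ∂μ =
      ‖h‖ₑ ^ 2 * ∫⁻ x, ‖fderiv ℝ φ x‖ₑ ^ 2 ∂μ := by
    rw [lintegral_add_left_eq_self (μ := μ) (fun x => ‖h‖ₑ ^ 2 * ‖fderiv ℝ φ x‖ₑ ^ 2),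
      lintegral_const_mul' _ _ (by simp)]
  simp only [hin, lintegral_const, measure_univ, mul_one, le_refl]

/-- Replacing a function by its averages over balls whose centres `p x` are `δ`-close to `x`. -/
theorem lintegral_sq_sub_average_le {φ : E → ℝ} (hφ : ContDiff ℝ 1 φ) {s : Set E}
    (hs : MeasurableSet s) {δ : ℝ} (hδ : 0 < δ) {p : E → E} (hp : ∀ x ∈ s, dist (p x) x < δ) :
    ∫⁻ x in s, ‖φ x - ⨍ y in Metric.ball (p x) δ, φ y ∂μ‖ₑ ^ 2 ∂μ ≤
      ENNReal.ofReal (2 ^ Module.finrank ℝ E * (2 * δ) ^ 2) *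
        ∫⁻ x, ‖fderiv ℝ φ x‖ₑ ^ 2 ∂μ := by
  set G := ∫⁻ x, ‖fderiv ℝ φ x‖ₑ ^ 2 ∂μ with hG
  set v := μ (Metric.ball (0 : E) δ) with hv
  have hv0 : v ≠ 0 := (Metric.measure_ball_pos μ 0 hδ).ne'
  have hvt : v ≠ ∞ := measure_ball_lt_top.ne
  have hball (x : E) : μ (Metric.ball x δ) = v := by
    rw [hv, Measure.addHaar_ball_center]
  have hpt (x : E) (hx : x ∈ s) : ‖φ x - ⨍ y in Metric.ball (p x) δ, φ y ∂μ‖ₑ ^ 2 ≤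
      v⁻¹ * ∫⁻ h in Metric.ball 0 (2 * δ), ‖φ (x + h) - φ x‖ₑ ^ 2 ∂μ := by
    set P : Measure E := v⁻¹ • μ.restrict (Metric.ball (p x) δ) with hP
    have hPp : IsProbabilityMeasure P := ⟨by
      simp [hP, hball, ENNReal.inv_mul_cancel hv0 hvt]⟩
    have hav : ⨍ y in Metric.ball (p x) δ, φ y ∂μ = ∫ y, φ y ∂P := by
      rw [average, Measure.restrict_apply_univ, hball]
    have hint : Integrable φ P := by
      refine Integrable.smul_measure ?_ (by simp [hv0])
      exact ((hφ.continuous.locallyIntegrable).integrableOn_isCompact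
        (isCompact_closedBall (p x) δ)).mono_set Metric.ball_subset_closedBall
    have h1 : φ x - ∫ y, φ y ∂P = ∫ y, (φ x - φ y) ∂P := by
      rw [integral_sub (integrable_const _) hint]
      simp
    rw [hav, h1]
    refine (enorm_integral_sq_le P
      (continuous_const.sub hφ.continuous).aestronglyMeasurable).trans ?_
    rw [hP, lintegral_smul_measure, smul_eq_mul]
    refine mul_le_mul_right ?_ _
    -- After recentring at `x` the larger ball no longer depends on `x`, so the integrals can be
    -- exchanged. The ratio of the two volumes produces the factor `2 ^ finrank`.
    have hsub : Metric.ball (p x) δ ⊆ Metric.ball x (2 * δ) := by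
      refine Metric.ball_subset_ball' ?_
      linarith [hp x hx]
    have h2 := (measurePreserving_add_left μ x).setLIntegral_comp_preimage
      (s := Metric.ball x (2 * δ)) measurableSet_ball (f := fun y => ‖φ x - φ y‖ₑ ^ 2)
      (by have := hφ.continuous; fun_prop)
    refine (lintegral_mono_set hsub).trans (h2.symm.trans_le ?_)
    have h3 : (fun y => x + y) ⁻¹' Metric.ball x (2 * δ) = Metric.ball 0 (2 * δ) := by
      ext y
      simp
    rw [h3]
    refine lintegral_mono fun y => ?_
    rw [← enorm_neg, neg_sub]
  have hmeas : Measurable fun q : E × E => ‖φ (q.1 + q.2) - φ q.1‖ₑ ^ 2 := by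
    have : Continuous fun q : E × E => φ (q.1 + q.2) - φ q.1 :=
      (hφ.continuous.comp (by fun_prop)).sub (hφ.continuous.comp continuous_fst)
    exact this.enorm.measurable.pow_const 2
  calc _ ≤ ∫⁻ x in s, v⁻¹ * ∫⁻ h in Metric.ball 0 (2 * δ), ‖φ (x + h) - φ x‖ₑ ^ 2 ∂μ ∂μ :=
        setLIntegral_mono' hs hpt
    _ ≤ ∫⁻ x, v⁻¹ * ∫⁻ h in Metric.ball 0 (2 * δ), ‖φ (x + h) - φ x‖ₑ ^ 2 ∂μ ∂μ :=
        setLIntegral_le_lintegral _ _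
    _ = v⁻¹ * ∫⁻ h in Metric.ball 0 (2 * δ), ∫⁻ x, ‖φ (x + h) - φ x‖ₑ ^ 2 ∂μ ∂μ := by
        rw [lintegral_const_mul' _ _ (by simp [hv0]),
          lintegral_lintegral_swap hmeas.aemeasurable]
    _ ≤ v⁻¹ * ∫⁻ _ in Metric.ball (0 : E) (2 * δ), ENNReal.ofReal ((2 * δ) ^ 2) * G ∂μ := by
        refine mul_le_mul_right (setLIntegral_mono' measurableSet_ball fun h hh => ?_) _
        refine (lintegral_sq_translate_sub_le μ hφ h).trans (mul_le_mul_left ?_ _)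
        rw [ENNReal.ofReal_pow (by positivity), ← ofReal_norm]
        gcongr
        exact (mem_ball_zero_iff.1 hh).le
    _ = _ := by
        rw [setLIntegral_const, Measure.addHaar_ball_of_pos μ 0 (by positivity : 0 < 2 * δ),
          mul_pow 2 δ (Module.finrank ℝ E), ENNReal.ofReal_mul (by positivity),
          mul_assoc (ENNReal.ofReal (2 ^ _)),
          ← Measure.addHaar_ball_of_pos μ 0 hδ, ← hv, ENNReal.ofReal_mul (by positivity)]
        rw [show v⁻¹ * (ENNReal.ofReal ((2 * δ) ^ 2) * G *
          (ENNReal.ofReal (2 ^ Module.finrank ℝ E) * v)) = (v⁻¹ * v) *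
          (ENNReal.ofReal (2 ^ Module.finrank ℝ E) * ENNReal.ofReal ((2 * δ) ^ 2) * G) by ring,
          ENNReal.inv_mul_cancel hv0 hvt, one_mul]

/-- The Poincaré inequality for functions that vanish outside a bounded set. -/
theorem exists_poincare [Nontrivial E] {s : Set E} (hs : Bornology.IsBounded s) :
    ∃ C : ℝ≥0, ∀ φ : E → ℝ, ContDiff ℝ 1 φ → Function.support φ ⊆ s →
      eLpNorm φ 2 μ ≤ C * eLpNorm (fderiv ℝ φ) 2 μ := by
  -- A translation longer than the diameter carries every point of `s` outside `s`, where `φ`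
  -- vanishes; thus `‖h‖` is a Poincaré constant.
  obtain ⟨h, hh⟩ := NormedSpace.exists_lt_norm ℝ E (Metric.diam s)
  refine ⟨‖h‖₊, fun φ hφ hsupp => ?_⟩
  rw [← ENNReal.pow_le_pow_left_iff two_ne_zero, mul_pow, eLpNorm_two_sq, eLpNorm_two_sq]
  refine le_trans ?_ (lintegral_sq_translate_sub_le μ hφ h)
  refine lintegral_mono fun x => ?_
  by_cases hx : x ∈ s
  · have : φ (x + h) = 0 := by
      by_contra hne
      have := Metric.dist_le_diam_of_mem hs (hsupp hne) hx
      simp only [dist_self_add_left] at this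
      linarith
    simp [this]
  · have : φ x = 0 := by
      by_contra hne
      exact hx (hsupp hne)
    simp [this]

end Translation

/-! ### The space H₀¹: density and Poincaré -/

theorem ConvexPolytope.isBounded (Ω : ConvexPolytope n) :
    Bornology.IsBounded (Ω.carrier : Set (EuclideanSpace ℝ (Fin n))) := by
  obtain ⟨t, ht⟩ := Ω.exists_vertices
  rw [ht]
  exact (t.finite_toSet.isCompact_convexHull (𝕜 := ℝ)).isBounded.subset interior_subset

/-- A test function and its gradient as an element of `L² × L²`. -/
noncomputable def testPair (Ω : ConvexPolytope n) (φ : 𝓓(Ω.carrier, ℝ)) : L2 Ω × L2V Ω :=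
  ((memLp_testFunction Ω φ).toLp φ, (memLp_gradient_testFunction Ω φ).toLp (∇ φ))

theorem testPair_add (Ω : ConvexPolytope n) (φ ψ : 𝓓(Ω.carrier, ℝ)) :
    testPair Ω (φ + ψ) = testPair Ω φ + testPair Ω ψ := by
  have h : ∇ ((φ + ψ : 𝓓(Ω.carrier, ℝ)) : EuclideanSpace ℝ (Fin n) → ℝ) = ∇ φ + ∇ ψ := by
    ext1 x
    have := fderiv_add (φ.contDiff.differentiable (by simp) x)
      (ψ.contDiff.differentiable (by simp) x)
    simp only [gradient, Pi.add_apply, ← map_add, ← this]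
    rfl
  refine Prod.ext rfl ?_
  exact MemLp.toLp_congr (memLp_gradient_testFunction Ω (φ + ψ))
    ((memLp_gradient_testFunction Ω φ).add (memLp_gradient_testFunction Ω ψ)) (by rw [h])

theorem testPair_smul (Ω : ConvexPolytope n) (r : ℝ) (φ : 𝓓(Ω.carrier, ℝ)) :
    testPair Ω (r • φ) = r • testPair Ω φ := by
  have h : ∇ ((r • φ : 𝓓(Ω.carrier, ℝ)) : EuclideanSpace ℝ (Fin n) → ℝ) = r • ∇ φ := by
    ext1 x
    have := fderiv_const_smul (φ.contDiff.differentiable (by simp) x) r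
    simp only [gradient, Pi.smul_apply, ← map_smul, ← this]
    rfl
  refine Prod.ext rfl ?_
  exact MemLp.toLp_congr (memLp_gradient_testFunction Ω (r • φ))
    ((memLp_gradient_testFunction Ω φ).const_smul r) (by rw [h])

/-- `H₀¹(Ω)` as a closed subspace of `L² × L²`. -/
noncomputable def H10Submodule (Ω : ConvexPolytope n) : Submodule ℝ (L2 Ω × L2V Ω) :=
  (LinearMap.range
    { toFun := testPair Ω
      map_add' := testPair_add Ω
      map_smul' := testPair_smul Ω : 𝓓(Ω.carrier, ℝ) →ₗ[ℝ] L2 Ω × L2V Ω }).topologicalClosure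

theorem H10_induction {Ω : ConvexPolytope n} {p : L2 Ω × L2V Ω → Prop}
    (hp : IsClosed {w | p w}) (h : ∀ φ, p (testPair Ω φ)) {w : L2 Ω × L2V Ω} (hw : w ∈ H10 Ω) :
    p w :=
  closure_minimal (t := {w | p w}) (by rintro _ ⟨φ, rfl⟩; exact h φ) hp hw

theorem support_testFunction_subset {Ω : ConvexPolytope n} (φ : 𝓓(Ω.carrier, ℝ)) :
    Function.support φ ⊆ (Ω.carrier : Set (EuclideanSpace ℝ (Fin n))) :=
  (subset_tsupport _).trans φ.tsupport_subset

theorem enorm_testPair_fst {Ω : ConvexPolytope n} (φ : 𝓓(Ω.carrier, ℝ)) :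
    ‖(testPair Ω φ).1‖ₑ = eLpNorm φ 2 volume := by
  rw [testPair, Lp.enorm_toLp]
  exact eLpNorm_restrict_eq_of_support_subset (support_testFunction_subset φ)

theorem enorm_testPair_snd {Ω : ConvexPolytope n} (φ : 𝓓(Ω.carrier, ℝ)) :
    ‖(testPair Ω φ).2‖ₑ = eLpNorm (fderiv ℝ φ) 2 volume := by
  have h : Function.support (fderiv ℝ φ) ⊆ (Ω.carrier : Set (EuclideanSpace ℝ (Fin n))) :=
    (support_fderiv_subset ℝ).trans φ.tsupport_subset
  rw [testPair, Lp.enorm_toLp, ← eLpNorm_restrict_eq_of_support_subset h (f := fderiv ℝ φ)]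
  refine eLpNorm_congr_norm_ae (Filter.Eventually.of_forall fun x => ?_)
  simp [gradient]

theorem H10_poincare (hn : 1 ≤ n) (Ω : ConvexPolytope n) :
    ∃ C : ℝ, 0 ≤ C ∧ ∀ w ∈ H10 Ω, ‖w.1‖ ≤ C * ‖w.2‖ := by
  have : Nonempty (Fin n) := ⟨⟨0, hn⟩⟩
  obtain ⟨C, hC⟩ := exists_poincare volume Ω.isBounded
  refine ⟨C, C.2, fun w hw => H10_induction (p := fun w => ‖w.1‖ ≤ C * ‖w.2‖)
    (isClosed_le (by fun_prop) (by fun_prop)) (fun φ => ?_) hw⟩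
  have h := hC φ (φ.contDiff.of_le (by simp)) (support_testFunction_subset φ)
  rw [← enorm_testPair_fst, ← enorm_testPair_snd, enorm_eq_nnnorm, enorm_eq_nnnorm] at h
  exact_mod_cast h

/-- Test functions belong to H₀¹, so this is the fundamental lemma of the calculus of variations. It
supplies the dense range of the embedding into L². -/
theorem eq_zero_of_inner_H10 {Ω : ConvexPolytope n} {f : L2 Ω}
    (hf : ∀ w ∈ H10 Ω, ⟪f, w.1⟫ = 0) : f = 0 := by
  refine (Lp.eq_zero_iff_ae_eq_zero).2 ?_
  refine (ae_restrict_iff' Ω.carrier.isOpen.measurableSet).2 ?_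
  refine Ω.carrier.isOpen.ae_eq_zero_of_integral_contDiff_smul_eq_zero
    (IntegrableOn.locallyIntegrableOn (integrable_L2 f)) fun g hg hgc hgs => ?_
  let φ : 𝓓(Ω.carrier, ℝ) := ⟨g, hg, hgc, hgs⟩
  have h := hf (testPair Ω φ) (subset_closure ⟨φ, rfl⟩)
  rw [inner_L2] at h
  have h2 : ∫ x, f x * (testPair Ω φ).1 x ∂Ω.measure = ∫ x, g x • f x ∂Ω.measure := by
    refine integral_congr_ae ?_
    filter_upwards [(memLp_testFunction Ω φ).coeFn_toLp] with x hx
    rw [testPair, hx, smul_eq_mul, mul_comm]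
    rfl
  rw [h2] at h
  rw [← h]
  refine (setIntegral_eq_integral_of_forall_compl_eq_zero fun x hx => ?_).symm
  have : g x = 0 := by
    by_contra hne
    exact hx (hgs (subset_tsupport _ hne))
  simp [this]

/-! ### Rellich compactness -/

/-- Send each point to the nearest member of a finite net. Finitely many centres make
`averageOperator` of finite rank, hence compact. -/
theorem exists_simpleFunc_dist_lt {s : Set (EuclideanSpace ℝ (Fin n))}
    (hs : Bornology.IsBounded s) {δ : ℝ} (hδ : 0 < δ) :
    ∃ p : SimpleFunc (EuclideanSpace ℝ (Fin n)) (EuclideanSpace ℝ (Fin n)),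
      ∀ x ∈ s, dist (p x) x < δ := by
  have hcover : closure s ⊆ ⋃ k : ℕ,
      Metric.ball (denseSeq (EuclideanSpace ℝ (Fin n)) k) δ := fun x _ => by
    obtain ⟨k, hk⟩ := (denseRange_denseSeq (EuclideanSpace ℝ (Fin n))).exists_dist_lt x hδ
    exact Set.mem_iUnion.2 ⟨k, hk⟩
  obtain ⟨t, ht⟩ := hs.isCompact_closure.elim_finite_subcover _
    (fun _ => Metric.isOpen_ball) hcover
  refine ⟨SimpleFunc.nearestPt (denseSeq _) (t.sup id), fun x hx => ?_⟩
  obtain ⟨k, hk, hxk⟩ := Set.mem_iUnion₂.1 (ht (subset_closure hx))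
  have h := SimpleFunc.edist_nearestPt_le (denseSeq (EuclideanSpace ℝ (Fin n))) x
    (Finset.le_sup (f := id) hk)
  rw [edist_dist, edist_dist, ENNReal.ofReal_le_ofReal_iff dist_nonneg, id] at h
  exact h.trans_lt (by simpa [dist_comm] using hxk)

/-- The operator replacing `f` by its averages over balls with centres `p x`. -/
noncomputable def averageOperator (Ω : ConvexPolytope n) (δ : ℝ)
    (p : SimpleFunc (EuclideanSpace ℝ (Fin n)) (EuclideanSpace ℝ (Fin n))) : L2 Ω →L[ℝ] L2 Ω :=
  ∑ q ∈ p.range, ((volume.real (Metric.ball q δ))⁻¹ •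
    innerSL ℝ (indicatorConstLp 2 (measurableSet_ball (x := q) (ε := δ))
      (measure_ne_top Ω.measure _) (1 : ℝ))).smulRight
    (indicatorConstLp 2 (p.measurableSet_fiber q) (measure_ne_top Ω.measure _) (1 : ℝ))

theorem isCompactOperator_sum_smulRight {ι E F : Type*} [NormedAddCommGroup E] [NormedSpace ℝ E]
    [NormedAddCommGroup F] [NormedSpace ℝ F] (s : Finset ι) (f : ι → E →L[ℝ] ℝ) (v : ι → F) :
    IsCompactOperator (∑ i ∈ s, (f i).smulRight (v i) : E →L[ℝ] F) := by
  induction s using Finset.cons_induction with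
  | empty => simpa using isCompactOperator_zero
  | cons i s his ih =>
    rw [Finset.sum_cons]
    exact ((isCompactOperator_of_locallyCompactSpace_dom (f i)).clm_comp
      (ContinuousLinearMap.toSpanSingleton ℝ (v i))).add ih

theorem isCompactOperator_averageOperator (Ω : ConvexPolytope n) (δ : ℝ)
    (p : SimpleFunc (EuclideanSpace ℝ (Fin n)) (EuclideanSpace ℝ (Fin n))) :
    IsCompactOperator (averageOperator Ω δ p) :=
  isCompactOperator_sum_smulRight _ _ _

theorem averageOperator_testFunction (Ω : ConvexPolytope n) (δ : ℝ)
    (p : SimpleFunc (EuclideanSpace ℝ (Fin n)) (EuclideanSpace ℝ (Fin n)))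
    (φ : 𝓓(Ω.carrier, ℝ)) :
    averageOperator Ω δ p (testPair Ω φ).1 =ᵐ[Ω.measure]
      fun x => ⨍ y in Metric.ball (p x) δ, φ y := by
  have hcoef (q : EuclideanSpace ℝ (Fin n)) :
      (volume.real (Metric.ball q δ))⁻¹ * ⟪indicatorConstLp 2 (measurableSet_ball (x := q) (ε := δ))
        (measure_ne_top Ω.measure _) (1 : ℝ), (testPair Ω φ).1⟫ =
        ⨍ y in Metric.ball q δ, φ y := by
    rw [setAverage_eq, L2.inner_indicatorConstLp_one, smul_eq_mul]
    congr 1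
    have h1 : ∫ x in Metric.ball q δ, (testPair Ω φ).1 x ∂Ω.measure =
        ∫ x in Metric.ball q δ, φ x ∂Ω.measure :=
      integral_congr_ae (ae_restrict_of_ae (memLp_testFunction Ω φ).coeFn_toLp)
    rw [h1, Measure.restrict_restrict measurableSet_ball]
    -- A ball may leave the domain, but `φ` vanishes there, so averaging over the full ball is
    -- harmless.
    refine (setIntegral_eq_of_subset_of_forall_sdiff_eq_zero measurableSet_ball
      Set.inter_subset_left fun x hx => ?_).symm
    by_contra hne
    exact hx.2 ⟨hx.1, support_testFunction_subset φ hne⟩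
  have hind : ∀ᵐ x ∂Ω.measure, ∀ q ∈ p.range,
      (indicatorConstLp 2 (p.measurableSet_fiber q) (measure_ne_top Ω.measure _) (1 : ℝ) : L2 Ω) x =
        (p ⁻¹' {q}).indicator (fun _ => (1 : ℝ)) x :=
    (Filter.eventually_all_finset p.range).2 fun q _ => indicatorConstLp_coeFn
  have hsm : ∀ᵐ x ∂Ω.measure, ∀ q ∈ p.range,
      ((⨍ y in Metric.ball q δ, φ y) • indicatorConstLp 2 (p.measurableSet_fiber q)
        (measure_ne_top Ω.measure _) (1 : ℝ) : L2 Ω) x = (⨍ y in Metric.ball q δ, φ y) *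
      (indicatorConstLp 2 (p.measurableSet_fiber q) (measure_ne_top Ω.measure _) (1 : ℝ) : L2 Ω) x :=
    (Filter.eventually_all_finset p.range).2 fun q _ => Lp.coeFn_smul _ _
  have hR : averageOperator Ω δ p (testPair Ω φ).1 =
      ∑ q ∈ p.range, (⨍ y in Metric.ball q δ, φ y) • (indicatorConstLp 2 (p.measurableSet_fiber q)
        (measure_ne_top Ω.measure _) (1 : ℝ) : L2 Ω) := by
    rw [averageOperator, _root_.sum_apply]
    refine Finset.sum_congr rfl fun q _ => ?_
    rw [← hcoef]
    rfl
  rw [hR]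
  filter_upwards [hind, hsm, Lp.coeFn_finsetSum p.range fun q =>
    (⨍ y in Metric.ball q δ, φ y) • (indicatorConstLp 2 (p.measurableSet_fiber q)
        (measure_ne_top Ω.measure _) (1 : ℝ) : L2 Ω)] with x e1 e2 e3
  rw [e3, Finset.sum_apply, Finset.sum_eq_single_of_mem (p x) (p.mem_range_self x)]
  · rw [e2 _ (p.mem_range_self x), e1 _ (p.mem_range_self x)]
    simp
  · intro q hq hne
    rw [e2 q hq, e1 q hq, Set.indicator_of_notMem (by simpa using hne.symm), mul_zero]

theorem norm_sub_averageOperator_le {Ω : ConvexPolytope n} {δ : ℝ} (hδ : 0 < δ)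
    {p : SimpleFunc (EuclideanSpace ℝ (Fin n)) (EuclideanSpace ℝ (Fin n))}
    (hp : ∀ x ∈ Ω.carrier, dist (p x) x < δ) {w : L2 Ω × L2V Ω} (hw : w ∈ H10 Ω) :
    ‖w.1 - averageOperator Ω δ p w.1‖ ≤ 2 ^ n * (2 * δ) * ‖w.2‖ := by
  refine H10_induction (p := fun w => ‖w.1 - averageOperator Ω δ p w.1‖ ≤
    2 ^ n * (2 * δ) * ‖w.2‖) (isClosed_le (by fun_prop) (by fun_prop)) (fun φ => ?_) hw
  have h := lintegral_sq_sub_average_le volume (φ := φ) (φ.contDiff.of_le (by simp))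
    Ω.carrier.isOpen.measurableSet hδ hp
  have h1 : ∫⁻ x in Ω.carrier, ‖φ x - ⨍ y in Metric.ball (p x) δ, φ y‖ₑ ^ 2 =
      ‖(testPair Ω φ).1 - averageOperator Ω δ p (testPair Ω φ).1‖ₑ ^ 2 := by
    rw [Lp.enorm_def, eLpNorm_two_sq]
    refine lintegral_congr_ae ?_
    filter_upwards [averageOperator_testFunction Ω δ p φ, (memLp_testFunction Ω φ).coeFn_toLp,
      Lp.coeFn_sub (testPair Ω φ).1 (averageOperator Ω δ p (testPair Ω φ).1)] with x e1 e2 e3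
    rw [e3, Pi.sub_apply, e1, testPair, e2]
  rw [h1, ← eLpNorm_two_sq, ← enorm_testPair_snd, ← ofReal_norm, ← ofReal_norm,
    ← ENNReal.ofReal_pow (norm_nonneg _), ← ENNReal.ofReal_pow (norm_nonneg _),
    ← ENNReal.ofReal_mul (by positivity), ENNReal.ofReal_le_ofReal_iff (by positivity),
    finrank_euclideanSpace_fin] at h
  refine le_of_sq_le_sq ?_ (by positivity)
  refine h.trans ?_
  rw [mul_pow _ ‖(testPair Ω φ).2‖, mul_pow ((2 : ℝ) ^ n)]
  gcongr
  -- The squared estimate has constant `2 ^ n`; weakening it to `(2 ^ n) ^ 2` avoids a square root.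
  exact le_self_pow₀ (one_le_pow₀ one_le_two) two_ne_zero

/-- Rellich: on `H₀¹(Ω)` the identity is approximated in `L²(Ω)` by compact operators. -/
theorem exists_isCompactOperator_norm_sub_le (Ω : ConvexPolytope n) {ε : ℝ} (hε : 0 < ε) :
    ∃ R : L2 Ω →L[ℝ] L2 Ω, IsCompactOperator R ∧ ∀ w ∈ H10 Ω, ‖w.1 - R w.1‖ ≤ ε * ‖w.2‖ := by
  have hδ : 0 < ε / (2 ^ n * 2) := by positivity
  obtain ⟨p, hp⟩ := exists_simpleFunc_dist_lt Ω.isBounded hδ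
  refine ⟨averageOperator Ω (ε / (2 ^ n * 2)) p, isCompactOperator_averageOperator Ω _ p, fun w hw => ?_⟩
  have h := norm_sub_averageOperator_le hδ hp hw
  rwa [show (2 : ℝ) ^ n * (2 * (ε / (2 ^ n * 2))) = ε by field_simp] at h

/-! ### Lax–Milgram and the spectral theorem -/

section SolutionOperator

variable {V H : Type*} [NormedAddCommGroup V] [InnerProductSpace ℝ V] [CompleteSpace V]
  [NormedAddCommGroup H] [InnerProductSpace ℝ H] [CompleteSpace H]

theorem exists_solution_operator {B : V →L[ℝ] V →L[ℝ] ℝ} (hB : IsCoercive B) (i : V →L[ℝ] H) :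
    ∃ G : H →L[ℝ] V, ∀ f v, v = G f ↔ ∀ w, B v w = ⟪f, i w⟫ := by
  refine ⟨(hB.continuousLinearEquivOfBilin.symm : V →L[ℝ] V) ∘L ContinuousLinearMap.adjoint i,
    fun f v => ?_⟩
  have h : v = hB.continuousLinearEquivOfBilin.symm (ContinuousLinearMap.adjoint i f) ↔
      hB.continuousLinearEquivOfBilin v = ContinuousLinearMap.adjoint i f :=
    (ContinuousLinearEquiv.eq_symm_apply _)
  refine h.trans ⟨fun h w => ?_, fun h => ext_inner_right ℝ fun w => ?_⟩
  · rw [← hB.continuousLinearEquivOfBilin_apply, h, ContinuousLinearMap.adjoint_inner_left]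
  · rw [hB.continuousLinearEquivOfBilin_apply, h, ContinuousLinearMap.adjoint_inner_left]

/-- With the convention `0⁻¹ = 0`, inversion is a bijection of `ℝ`, so reindexing the eigenspaces of
`T` loses none. -/
theorem isHilbertSum_eigenspaces_inv {T : H →L[ℝ] H} (hT : IsCompactOperator T)
    (hT' : T.IsSymmetric) {F : ℝ → Submodule ℝ H} [∀ l, CompleteSpace (F l)]
    (hF : ∀ l, F l = Module.End.eigenspace (T : Module.End ℝ H) l⁻¹) :
    IsHilbertSum ℝ (fun l => F l) fun l => (F l).subtypeₗᵢ := by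
  refine IsHilbertSum.mkInternal (F := F) ?_ ?_
  · intro i j hij v w
    exact hT'.orthogonalFamily_eigenspaces (fun h => hij (inv_injective h))
      ⟨v, (hF i).le v.2⟩ ⟨w, (hF j).le w.2⟩
  · have h : ⨆ l, F l = ⨆ m, Module.End.eigenspace (T : Module.End ℝ H) m := by
      simp only [hF]
      exact inv_surjective.iSup_comp fun m => Module.End.eigenspace (T : Module.End ℝ H) m
    rw [h, Submodule.topologicalClosure_eq_top_iff.2
      (ContinuousLinearMap.orthogonalComplement_iSup_eigenspaces_eq_bot hT hT')]

/-- Spectral theory of the eigenvalue problem `B v w = l ⟪i v, i w⟫` for a coercive symmetric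
form and a compact map `i` with dense range. -/
theorem exists_compact_solution_operator {B : V →L[ℝ] V →L[ℝ] ℝ} (hB : IsCoercive B)
    (hsymm : ∀ v w, B v w = B w v) {i : V →L[ℝ] H} (hi : IsCompactOperator i)
    (hdense : ∀ f, (∀ w, ⟪f, i w⟫ = 0) → f = 0) :
    ∃ T : H →L[ℝ] H, IsCompactOperator T ∧ T.IsSymmetric ∧
      ∀ l f, T f = l⁻¹ • f ↔ ∃ v, i v = f ∧ ∀ w, B v w = l * ⟪f, i w⟫ := by
  obtain ⟨G, hG⟩ := exists_solution_operator hB i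
  have hGB (f : H) (w : V) : B (G f) w = ⟪f, i w⟫ := (hG f (G f)).1 rfl w
  refine ⟨i ∘L G, hi.comp_clm G, fun f g => ?_, fun l f => ?_⟩
  · change ⟪i (G f), g⟫ = ⟪f, i (G g)⟫
    rw [← hGB, hsymm, hGB, real_inner_comm]
  · have h1 : (∃ v, i v = f ∧ ∀ w, B v w = l * ⟪f, i w⟫) ↔ l • i (G f) = f := by
      constructor
      · rintro ⟨v, hv, h⟩
        have : v = G (l • f) := (hG _ _).2 fun w => by rw [h, inner_smul_left]; rfl
        rw [map_smul] at this
        rw [← map_smul, ← this, hv]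
      · intro h
        refine ⟨l • G f, by rw [map_smul, h], fun w => ?_⟩
        rw [map_smul, ← hGB]
        rfl
    rw [h1]
    change i (G f) = l⁻¹ • f ↔ _
    -- At `l = 0` the right side says `f = 0`, and the left says that `f` lies in the kernel of `T`.
    -- That kernel is trivial: coercivity forces `G f = 0`, and dense range then forces `f = 0`.
    by_cases hl : l = 0
    · subst hl
      simp only [inv_zero, zero_smul]
      constructor
      · intro h
        have h0 : G f = 0 := by
          obtain ⟨C, hC, hcoer⟩ := hB
          have h2 := hcoer (G f)
          rw [hGB, h, inner_zero_right] at h2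
          rw [← norm_eq_zero]
          have := norm_nonneg (G f)
          by_contra hne
          have : 0 < ‖G f‖ := lt_of_le_of_ne this (Ne.symm hne)
          have : 0 < C * ‖G f‖ * ‖G f‖ := by positivity
          linarith
        refine (hdense f fun w => ?_).symm
        rw [← hGB, h0]
        simp
      · rintro rfl
        simp
    · exact eq_inv_smul_iff₀ hl

omit [CompleteSpace V] in
theorem isCompactOperator_of_approx {f : V →L[ℝ] H}
    (h : ∀ ε : ℝ, 0 < ε → ∃ g : V →L[ℝ] H, IsCompactOperator g ∧ ∀ v, ‖f v - g v‖ ≤ ε * ‖v‖) :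
    IsCompactOperator f := by
  refine (isClosed_setOfPred_isCompactOperator (σ₁₂ := RingHom.id ℝ)).closure_subset
    (Metric.mem_closure_iff.2 fun ε hε => ?_)
  obtain ⟨g, hg, hfg⟩ := h (ε / 2) (half_pos hε)
  refine ⟨g, hg, ?_⟩
  rw [dist_eq_norm]
  exact (ContinuousLinearMap.opNorm_le_bound _ (half_pos hε).le hfg).trans_lt (half_lt_self hε)

end SolutionOperator


/-! ### The energy form and its spectrum -/

/-- Multiplication by the coefficients as bounded operators. -/
theorem exists_coefficient_operators {Ω : ConvexPolytope n}
    {A : EuclideanSpace ℝ (Fin n) → Matrix (Fin n) (Fin n) ℝ} {c : EuclideanSpace ℝ (Fin n) → ℝ}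
    (hAc : IsEllipticCoeff Ω A c) :
    ∃ (M : L2V Ω →L[ℝ] L2V Ω) (m : L2 Ω →L[ℝ] L2 Ω),
      (∀ g, M g =ᵐ[Ω.measure] fun x => (A x).toEuclideanLin (g x)) ∧
      ∀ f, m f =ᵐ[Ω.measure] fun x => c x * f x := by
  choose K hK using hAc.lipschitz
  -- Extending the Lipschitz entries to the whole space makes the matrix field continuous, hence
  -- measurable and bounded on the compact closure of the domain.
  choose A' hA' hAA' using fun i j => (hK i j).extend_real
  let Φ : Matrix (Fin n) (Fin n) ℝ →ₗ[ℝ]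
      EuclideanSpace ℝ (Fin n) →L[ℝ] EuclideanSpace ℝ (Fin n) :=
    LinearMap.toContinuousLinearMap.toLinearMap ∘ₗ Matrix.toEuclideanLin.toLinearMap
  let A₁ : EuclideanSpace ℝ (Fin n) → EuclideanSpace ℝ (Fin n) →L[ℝ] EuclideanSpace ℝ (Fin n) :=
    fun x => Φ (Matrix.of fun i j => A' i j x)
  have hcont : Continuous A₁ :=
    (LinearMap.continuous_of_finiteDimensional Φ).comp
      (continuous_matrix fun i j => (hA' i j).continuous)
  have heq (x : EuclideanSpace ℝ (Fin n)) (hx : x ∈ Ω.carrier) (ξ : EuclideanSpace ℝ (Fin n)) :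
      A₁ x ξ = (A x).toEuclideanLin ξ := by
    have : (Matrix.of fun i j => A' i j x) = A x := by
      ext i j
      exact (hAA' i j hx).symm
    simp only [A₁, this]
    rfl
  obtain ⟨C, hC⟩ := (Ω.isBounded.isCompact_closure).exists_bound_of_continuousOn hcont.continuousOn
  have hA₁ : MemLp A₁ ∞ Ω.measure := by
    refine memLp_top_of_bound hcont.aestronglyMeasurable C ?_
    filter_upwards [ae_restrict_mem Ω.carrier.isOpen.measurableSet] with x hx
    exact hC x (subset_closure hx)
  refine ⟨(ContinuousLinearMap.id ℝ (EuclideanSpace ℝ (Fin n) →L[ℝ] EuclideanSpace ℝ (Fin n))).holderL Ω.measure ∞ 2 2 hA₁.toLp,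
    (ContinuousLinearMap.mul ℝ ℝ).holderL Ω.measure ∞ 2 2 hAc.c_memLp.toLp, fun g => ?_,
    fun f => ?_⟩
  · filter_upwards [ContinuousLinearMap.coeFn_holder (r := 2)
      (ContinuousLinearMap.id ℝ (EuclideanSpace ℝ (Fin n) →L[ℝ] EuclideanSpace ℝ (Fin n))) hA₁.toLp g, hA₁.coeFn_toLp,
      ae_restrict_mem Ω.carrier.isOpen.measurableSet] with x e1 e2 hx
    rw [ContinuousLinearMap.holderL_apply_apply, e1, e2]
    exact heq x hx _
  · filter_upwards [ContinuousLinearMap.coeFn_holder (r := 2)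
      (ContinuousLinearMap.mul ℝ ℝ) hAc.c_memLp.toLp f, hAc.c_memLp.coeFn_toLp] with x e1 e2
    rw [ContinuousLinearMap.holderL_apply_apply, e1, e2]
    rfl

theorem energyForm_eq {Ω : ConvexPolytope n}
    {A : EuclideanSpace ℝ (Fin n) → Matrix (Fin n) (Fin n) ℝ} {c : EuclideanSpace ℝ (Fin n) → ℝ}
    {M : L2V Ω →L[ℝ] L2V Ω} {m : L2 Ω →L[ℝ] L2 Ω}
    (hM : ∀ g, M g =ᵐ[Ω.measure] fun x => (A x).toEuclideanLin (g x))
    (hm : ∀ f, m f =ᵐ[Ω.measure] fun x => c x * f x) (v w : L2 Ω × L2V Ω) :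
    energyForm Ω A c v w = ⟪M v.2, w.2⟫ + ⟪m v.1, w.1⟫ := by
  rw [L2.inner_def, inner_L2, energyForm,
    ← integral_add (L2.integrable_inner _ _) (integrable_mul_L2 _ _)]
  refine integral_congr_ae ?_
  filter_upwards [hM v.2, hm v.1] with x e1 e2
  rw [e1, e2]

theorem energyForm_symm {Ω : ConvexPolytope n}
    {A : EuclideanSpace ℝ (Fin n) → Matrix (Fin n) (Fin n) ℝ} {c : EuclideanSpace ℝ (Fin n) → ℝ}
    (hAc : IsEllipticCoeff Ω A c) (v w : L2 Ω × L2V Ω) :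
    energyForm Ω A c v w = energyForm Ω A c w v := by
  refine integral_congr_ae ?_
  filter_upwards [ae_restrict_mem Ω.carrier.isOpen.measurableSet] with x hx
  have h : (A x).IsHermitian := by
    rw [Matrix.IsHermitian, Matrix.conjTranspose_eq_transpose_of_trivial]
    exact hAc.symm x hx
  have h2 := (Matrix.isSymmetric_toEuclideanLin_iff.2 h) (v.2 x) (w.2 x)
  rw [h2, real_inner_comm]
  ring

theorem exists_energyForm_coercive {Ω : ConvexPolytope n}
    {A : EuclideanSpace ℝ (Fin n) → Matrix (Fin n) (Fin n) ℝ} {c : EuclideanSpace ℝ (Fin n) → ℝ}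
    (hAc : IsEllipticCoeff Ω A c) :
    ∃ α : ℝ, 0 < α ∧ ∀ v : L2 Ω × L2V Ω, α * ‖v.2‖ ^ 2 ≤ energyForm Ω A c v v := by
  obtain ⟨α, hα, hell⟩ := hAc.elliptic
  obtain ⟨M, m, hM, hm⟩ := exists_coefficient_operators hAc
  refine ⟨α, hα, fun v => ?_⟩
  rw [energyForm_eq hM hm]
  have h1 : α * ‖v.2‖ ^ 2 ≤ ⟪M v.2, v.2⟫ := by
    rw [← real_inner_self_eq_norm_sq, L2.inner_def, L2.inner_def, ← integral_const_mul]
    refine integral_mono_ae ((L2.integrable_inner _ _).const_mul α) (L2.integrable_inner _ _) ?_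
    filter_upwards [hM v.2, ae_restrict_mem Ω.carrier.isOpen.measurableSet] with x e hx
    rw [e, real_inner_self_eq_norm_sq]
    exact hell x hx _
  have h2 : 0 ≤ ⟪m v.1, v.1⟫ := by
    rw [inner_L2]
    refine integral_nonneg_of_ae ?_
    filter_upwards [hm v.1, hAc.c_nonneg] with x e hc
    rw [e, mul_assoc]
    exact mul_nonneg hc (mul_self_nonneg _)
  linarith

/-- `H₀¹(Ω)` as a Hilbert space. -/
noncomputable def sobolevSpace (Ω : ConvexPolytope n) : Submodule ℝ (WithLp 2 (L2 Ω × L2V Ω)) :=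
  (H10Submodule Ω).comap (WithLp.linearEquiv 2 ℝ (L2 Ω × L2V Ω)).toLinearMap

instance sobolevSpace_completeSpace (Ω : ConvexPolytope n) : CompleteSpace (sobolevSpace Ω) := by
  have : IsClosed (sobolevSpace Ω : Set (WithLp 2 (L2 Ω × L2V Ω))) :=
    isClosed_closure.preimage (WithLp.prod_continuous_ofLp 2 _ _)
  exact this.completeSpace_coe

/-- The embedding of `H₀¹(Ω)` into `L²(Ω)`. -/
noncomputable def sobolevEmbedding (Ω : ConvexPolytope n) : sobolevSpace Ω →L[ℝ] L2 Ω :=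
  (WithLp.fstL 2 ℝ (L2 Ω) (L2V Ω)) ∘L (sobolevSpace Ω).subtypeL

theorem isCompactOperator_sobolevEmbedding (Ω : ConvexPolytope n) :
    IsCompactOperator (sobolevEmbedding Ω) := by
  refine isCompactOperator_of_approx fun ε hε => ?_
  obtain ⟨R, hR, h⟩ := exists_isCompactOperator_norm_sub_le Ω hε
  refine ⟨R ∘L sobolevEmbedding Ω, hR.comp_clm _, fun v => (h v.1.ofLp v.2).trans ?_⟩
  gcongr
  exact WithLp.norm_snd_le (p := 2) _ v.1

/-- The energy form is a bounded bilinear form on `H₀¹(Ω)`. -/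
theorem exists_energy_bilin {Ω : ConvexPolytope n}
    {A : EuclideanSpace ℝ (Fin n) → Matrix (Fin n) (Fin n) ℝ} {c : EuclideanSpace ℝ (Fin n) → ℝ}
    (hAc : IsEllipticCoeff Ω A c) :
    ∃ B : sobolevSpace Ω →L[ℝ] sobolevSpace Ω →L[ℝ] ℝ,
      ∀ v w, B v w = energyForm Ω A c v.1.ofLp w.1.ofLp := by
  obtain ⟨M, m, hM, hm⟩ := exists_coefficient_operators hAc
  let B : sobolevSpace Ω →ₗ[ℝ] sobolevSpace Ω →ₗ[ℝ] ℝ :=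
    LinearMap.mk₂ ℝ (fun v w => ⟪M v.1.ofLp.2, w.1.ofLp.2⟫ + ⟪m v.1.ofLp.1, w.1.ofLp.1⟫)
      (fun u v w => by simp [inner_add_left]; ring)
      (fun r v w => by simp [inner_smul_left]; ring)
      (fun u v w => by simp [inner_add_right]; ring)
      (fun r v w => by simp [inner_smul_right]; ring)
  refine ⟨B.mkContinuous₂ (‖M‖ + ‖m‖) fun v w => ?_, fun v w => (energyForm_eq hM hm _ _).symm⟩
  have h1 : ‖⟪M v.1.ofLp.2, w.1.ofLp.2⟫‖ ≤ ‖M‖ * ‖v‖ * ‖w‖ := by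
    refine (norm_inner_le_norm _ _).trans ?_
    gcongr
    · exact (M.le_opNorm _).trans (by gcongr; exact WithLp.norm_snd_le (p := 2) _ v.1)
    · exact WithLp.norm_snd_le (p := 2) _ w.1
  have h2 : ‖⟪m v.1.ofLp.1, w.1.ofLp.1⟫‖ ≤ ‖m‖ * ‖v‖ * ‖w‖ := by
    refine (norm_inner_le_norm _ _).trans ?_
    gcongr
    · exact (m.le_opNorm _).trans (by gcongr; exact WithLp.norm_fst_le (p := 2) _ v.1)
    · exact WithLp.norm_fst_le (p := 2) _ w.1
  refine (norm_add_le _ _).trans ?_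
  linarith

theorem eigenspace_bounds_and_isHilbertSum (hn : 1 ≤ n) {Ω : ConvexPolytope n}
    {A : EuclideanSpace ℝ (Fin n) → Matrix (Fin n) (Fin n) ℝ} {c : EuclideanSpace ℝ (Fin n) → ℝ}
    (hAc : IsEllipticCoeff Ω A c) :
    (∃ l₀ : ℝ, 0 < l₀ ∧ ∀ lam, eigenspace Ω A c lam ≠ ⊥ → l₀ ≤ lam) ∧
    IsHilbertSum ℝ (fun lam => eigenspace Ω A c lam)
      fun lam => (eigenspace Ω A c lam).subtypeₗᵢ := by
  obtain ⟨C, hC, hpoin⟩ := H10_poincare hn Ω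
  obtain ⟨α, hα, hcoer⟩ := exists_energyForm_coercive hAc
  obtain ⟨B, hB⟩ := exists_energy_bilin hAc
  -- Poincaré bounds the squared H¹ norm by `C ^ 2 + 1` times the squared gradient norm, so `κ` is a
  -- coercivity constant.
  set κ := α / (C ^ 2 + 1) with hκ
  have hκ0 : 0 < κ := by positivity
  have hlow (v : L2 Ω × L2V Ω) (hv : v ∈ H10 Ω) :
      κ * (‖v.1‖ ^ 2 + ‖v.2‖ ^ 2) ≤ energyForm Ω A c v v := by
    refine le_trans ?_ (hcoer v)
    have h1 : ‖v.1‖ ^ 2 ≤ C ^ 2 * ‖v.2‖ ^ 2 := by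
      rw [← mul_pow]
      gcongr
      exact hpoin v hv
    have h2 : κ * (C ^ 2 + 1) = α := by rw [hκ]; field_simp
    calc _ ≤ κ * (C ^ 2 * ‖v.2‖ ^ 2 + ‖v.2‖ ^ 2) := by gcongr
      _ = κ * (C ^ 2 + 1) * ‖v.2‖ ^ 2 := by ring
      _ = _ := by rw [h2]
  have hBc : IsCoercive B := by
    refine ⟨κ, hκ0, fun v => ?_⟩
    have h := hlow v.1.ofLp v.2
    rw [hB, mul_assoc, ← sq]
    refine le_trans (le_of_eq ?_) h
    congr 1
    exact WithLp.prod_norm_sq_eq_of_L2 v.1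
  obtain ⟨T, hT, hT', hTe⟩ := exists_compact_solution_operator hBc
    (fun v w => by rw [hB, hB, energyForm_symm hAc])
    (isCompactOperator_sobolevEmbedding Ω)
    (fun f hf => eq_zero_of_inner_H10 fun w hw => hf ⟨WithLp.toLp 2 w, hw⟩)
  have hset (lam : ℝ) (φ : L2 Ω) : IsEigenfunction Ω A c lam φ ↔ T φ = lam⁻¹ • φ := by
    rw [hTe]
    constructor
    · rintro ⟨g, hg, h⟩
      refine ⟨⟨WithLp.toLp 2 (φ, g), hg⟩, rfl, fun w => ?_⟩
      rw [hB]
      exact h _ w.2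
    · rintro ⟨v, rfl, h⟩
      refine ⟨v.1.ofLp.2, v.2, fun w hw => ?_⟩
      have := h ⟨WithLp.toLp 2 w, hw⟩
      rw [hB] at this
      exact this
  have heig (lam : ℝ) :
      eigenspace Ω A c lam = Module.End.eigenspace (T : Module.End ℝ (L2 Ω)) lam⁻¹ := by
    have h1 : {φ | IsEigenfunction Ω A c lam φ} =
        (Module.End.eigenspace (T : Module.End ℝ (L2 Ω)) lam⁻¹ : Set (L2 Ω)) := by
      ext φ
      exact (hset lam φ).trans Module.End.mem_eigenspace_iff.symm
    have h2 : IsClosed (Module.End.eigenspace (T : Module.End ℝ (L2 Ω)) lam⁻¹ : Set (L2 Ω)) := by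
      have : IsClosed {φ : L2 Ω | T φ = lam⁻¹ • φ} := isClosed_eq (by fun_prop) (by fun_prop)
      convert this using 1
      ext φ
      exact Module.End.mem_eigenspace_iff
    rw [eigenspace, h1, Submodule.span_eq, h2.submodule_topologicalClosure_eq]
  refine ⟨⟨κ, hκ0, fun lam hne => ?_⟩, isHilbertSum_eigenspaces_inv hT hT' heig⟩
  -- Testing the eigenvalue equation with the eigenfunction itself gives `κ * ‖φ‖ ^ 2 ≤ lam * ‖φ‖ ^
  -- 2`.
  obtain ⟨φ, hφ, hφ0⟩ := Submodule.exists_mem_ne_zero_of_ne_bot hne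
  rw [heig, Module.End.mem_eigenspace_iff] at hφ
  obtain ⟨g, hg, h⟩ := (hset lam φ).2 hφ
  have h1 := hlow _ hg
  rw [h _ hg, real_inner_self_eq_norm_sq] at h1
  have h2 : 0 < ‖φ‖ ^ 2 := by positivity
  refine le_of_mul_le_mul_right (le_trans ?_ h1) h2
  gcongr
  simp

end FracControl

theorem mainTheorem5 {n : ℕ} (hn : 1 ≤ n) (Ω : FracControl.ConvexPolytope n)
    (A : EuclideanSpace ℝ (Fin n) → Matrix (Fin n) (Fin n) ℝ)
    (c : EuclideanSpace ℝ (Fin n) → ℝ) (hAc : FracControl.IsEllipticCoeff Ω A c)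
    (s : ℝ) (hs0 : 0 < s) (hs1 : s < 1)
    (σ ν : ℝ) (hσ : 0 < σ) (hν : 0 < ν)
    (a b : ℝ) (ha : a < 0) (hb : 0 < b)
    (ud : FracControl.L2 Ω) :
    ∃ S : FracControl.L2 Ω →L[ℝ] FracControl.L2 Ω,
      (∀ z u, FracControl.SolvesState Ω A c s u z ↔ u = S z) ∧
      ∀ u ∈ FracControl.Hs Ω A c s, ∀ z ∈ FracControl.Zad Ω a b,
        (FracControl.IsOptimalPair Ω A c s ud σ ν a b u z ↔
          u = S z ∧
          ∃ l : Lp ℝ ∞ Ω.measure,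
            FracControl.linftyFunctional Ω l ∈
              FracControl.subdifferential (FracControl.psi Ω)
                (FracControl.lpIncl 1 one_le_two z) ∧
            ∀ w ∈ FracControl.Zad Ω a b,
              0 ≤ ⟪ContinuousLinearMap.adjoint S (S z - ud) + σ • z +
                ν • FracControl.lpIncl 2 le_top l, w - z⟫) := by
  obtain ⟨⟨l₀, hl₀, hl⟩, hV⟩ := FracControl.eigenspace_bounds_and_isHilbertSum hn hAc
  obtain ⟨S, hS⟩ := FracControl.exists_state_operator hV hl₀ hl hs0
  exact ⟨S, hS, fun u _ z hz => FracControl.isOptimalPair_iff hσ hν ha hb ud hS u hz⟩
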